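/- **Conventions.** An *MT-space* is a set with a topology and a $\sigma$-algebra (no compatibility is required); an *MT-map* is a continuous measurable map; subsets and products carry the induced topologies and $\sigma$-algebras. Standard Borel parameter spaces $T$ carry the discrete topology; balls and simplices carry the Euclidean topology and its Borel $\sigma$-algebra. A *measurable lamination* $\mathcal F$ of dimension $d$ is an MT-space $X$ covered by the domains of countably many measurable charts $\varphi:U\to B\times T$, where $U\subset X$ is open and measurable, $B\subset\mathbb R^d$ is an open ball, $T$ is a standard Borel space, and $\varphi$ is a homeomorphism and a measurable isomorphism. Its leaves are the connected components of $X$; likewise, the leaves of an open measurable $U\subset X$ are the connected components of $U$. A measurable open set $U\subset X$ is *categorical* if there is an MT-map $H:U\times\mathbb R\to X$ such that $H(\cdot,0)$ is the inclusion and $H(\cdot,1)$ is constant on each leaf of $U$. $\operatorname{Cat}(\mathcal F)\in\mathbb N\cup\{\infty\}$ is the least number of categorical measurable open sets that cover $X$ ($\infty$ if no finite number does). Let $\Gamma$ be a *standard ring*: a ring whose underlying set is a standard Borel space and whose operations are measurable. A singular cochain $\omega:\{\text{continuous maps }\Delta^n\to X\}\to\Gamma$ is *measurable* if, for every standard Borel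 space $T$ and every MT-map $\sigma:\Delta^n\times T\to X$, the function $t\mapsto\omega(\sigma(\cdot,t))$ is measurable. Measurable cochains form a subcomplex of the singular cochain complex, closed under the cup product. Let $H^n_{\mathrm{MT}}(\mathcal F,\Gamma)$ be its $n$-th cohomology group (measurable cocycles modulo coboundaries of measurable cochains); the cup product makes $\bigoplus_{n\ge1}H^n_{\mathrm{MT}}(\mathcal F,\Gamma)$ a graded ring, without unit. The nilpotency order $\operatorname{Nil}(R)\in\mathbb N\cup\{\infty\}$ of a ring $R$ is the least $k\ge1$ such that every product of $k$ elements of $R$ is zero ($\infty$ if there is none). **Statement.** For every nonempty measurable lamination $\mathcal F$ and every standard ring $\Gamma$, $$\operatorname{Nil}\Big(\bigoplus_{n\ge1}H^n_{\mathrm{MT}}(\mathcal F,\Gamma),+,\smile\Big)\le\operatorname{Cat}(\mathcal F).$$ -/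

import Mathlib

/-! A measurable topological space (MT-space) is a type carrying both a topology and a
`σ`-algebra, which are not assumed to be related in any way. -/

namespace MT

open scoped DirectSum

/-- MT-maps: measurable continuous maps. -/
structure IsMTMap {X Y : Type*} [TopologicalSpace X] [MeasurableSpace X]
    [TopologicalSpace Y] [MeasurableSpace Y] (f : X → Y) : Prop where
  continuous : Continuous f
  measurable : Measurable f

/-! ### Measurable laminations -/

/-- A measurable chart `φ : U → B × T` of dimension `d` on an MT-space `X`: the set `U` is open and
measurable, `B` is an open ball of `ℝ^d`, `T` is a standard Borel space with the discrete topology,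
and `φ` is a homeomorphism and a measurable isomorphism. (Every standard Borel space is Borel
isomorphic to one in the lowest universe, so `T : Type` loses nothing.) -/
structure Chart (d : ℕ) (X : Type*) [TopologicalSpace X] [MeasurableSpace X] where
  domain : Set X
  isOpen_domain : IsOpen domain
  measurableSet_domain : MeasurableSet domain
  center : EuclideanSpace ℝ (Fin d)
  radius : ℝ
  radius_pos : 0 < radius
  T : Type
  [measurableSpaceT : MeasurableSpace T]
  [standardBorelT : StandardBorelSpace T]
  [topologyT : TopologicalSpace T]
  [discreteT : DiscreteTopology T]
  toHomeo : domain ≃ₜ Metric.ball center radius × T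
  measurable_toHomeo : Measurable toHomeo
  measurable_symm : Measurable toHomeo.symm

/-- `X` is (the ambient space of) a measurable lamination of dimension `d`: it admits a countable
measurable atlas. Its leaves are the connected components of `X`. -/
def IsMeasurableLamination (d : ℕ) (X : Type*) [TopologicalSpace X] [MeasurableSpace X] : Prop :=
  ∃ A : Set (Chart d X), A.Countable ∧ ⋃ φ ∈ A, φ.domain = Set.univ

/-- A measurable contraction of `U` in `X`: an MT-map `H : U × ℝ → X` such that `H(·, 0)` is the
inclusion and `H(·, 1)` is constant on each leaf (i.e. connected component) of `U`. -/
structure IsContraction {X : Type*} [TopologicalSpace X] [MeasurableSpace X] (U : Set X)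
    (H : U × ℝ → X) : Prop where
  isMTMap : IsMTMap H
  map_zero : ∀ x : U, H (x, 0) = x
  map_one : ∀ x y : U, y ∈ connectedComponent x → H (y, 1) = H (x, 1)

/-- Categorical measurable open sets. -/
structure IsCategorical {X : Type*} [TopologicalSpace X] [MeasurableSpace X] (U : Set X) :
    Prop where
  isOpen : IsOpen U
  measurableSet : MeasurableSet U
  exists_contraction : ∃ H : U × ℝ → X, IsContraction U H

/-- The (LS) category: the least number of categorical measurable open sets that cover `X`
(`⊤` if no finite family does). -/
noncomputable def cat (X : Type*) [TopologicalSpace X] [MeasurableSpace X] : ℕ∞ :=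
  sInf {k | ∃ 𝒰 : Set (Set X), (∀ U ∈ 𝒰, IsCategorical U) ∧ ⋃₀ 𝒰 = Set.univ ∧ 𝒰.encard = k}

/-! ### Singular cochains -/

/-- The canonical `n`-simplex. -/
abbrev Simplex (n : ℕ) : Type := stdSimplex ℝ (Fin (n + 1))

/-- Singular simplices of `X`. -/
abbrev SingularSimplex (X : Type*) [TopologicalSpace X] (n : ℕ) : Type _ := C(Simplex n, X)

/-- The composition of a singular simplex with the affine map of standard simplices that is
given on vertices by `f`. -/
noncomputable def SingularSimplex.pull {X : Type*} [TopologicalSpace X] {a b : ℕ}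
    (σ : SingularSimplex X b) (f : Fin (a + 1) → Fin (b + 1)) : SingularSimplex X a :=
  σ.comp ⟨stdSimplex.map f, stdSimplex.continuous_map f⟩

theorem SingularSimplex.pull_pull {X : Type*} [TopologicalSpace X] {a b c : ℕ}
    (σ : SingularSimplex X c) (g : Fin (b + 1) → Fin (c + 1)) (f : Fin (a + 1) → Fin (b + 1)) :
    (σ.pull g).pull f = σ.pull (g ∘ f) := by
  ext x
  simp [SingularSimplex.pull, stdSimplex.map_comp_apply]

/-- Singular `n`-cochains with values in `Γ`. -/
abbrev Cochain (X Γ : Type*) [TopologicalSpace X] (n : ℕ) : Type _ := SingularSimplex X n → Γ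

/-- The singular coboundary operator. -/
noncomputable def coboundary {X Γ : Type*} [TopologicalSpace X] [AddCommGroup Γ] (n : ℕ) :
    Cochain X Γ n →+ Cochain X Γ (n + 1) where
  toFun ω := fun σ => ∑ i : Fin (n + 2), (-1 : ℤ) ^ (i : ℕ) • ω (σ.pull i.succAbove)
  map_zero' := by
    funext σ
    simp
  map_add' ω θ := by
    funext σ
    simp [smul_add, Finset.sum_add_distrib]

/-- The front `n`-face `[v₀, …, vₙ]` of the standard `k`-simplex, where `n + m = k`. -/
def front {n m k : ℕ} (h : n + m = k) (j : Fin (n + 1)) : Fin (k + 1) :=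
  ⟨j, by omega⟩

/-- The back `m`-face `[vₙ, …, vₙ₊ₘ]` of the standard `k`-simplex, where `n + m = k`. -/
def back {n m k : ℕ} (h : n + m = k) (j : Fin (m + 1)) : Fin (k + 1) :=
  ⟨n + j, by omega⟩

/-- The cup product of singular cochains of degrees `n` and `m`. -/
noncomputable def cup {X Γ : Type*} [TopologicalSpace X] [Mul Γ] {n m k : ℕ} (h : n + m = k)
    (ω : Cochain X Γ n) (θ : Cochain X Γ m) : Cochain X Γ k :=
  fun σ => ω (σ.pull (front h)) * θ (σ.pull (back h))

theorem cup_add {X Γ : Type*} [TopologicalSpace X] [NonUnitalRing Γ] {n m k : ℕ}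
    (h : n + m = k) (ω : Cochain X Γ n) (θ θ' : Cochain X Γ m) :
    cup h ω (θ + θ') = cup h ω θ + cup h ω θ' := by
  funext σ
  simp [cup, mul_add]

theorem add_cup {X Γ : Type*} [TopologicalSpace X] [NonUnitalRing Γ] {n m k : ℕ}
    (h : n + m = k) (ω ω' : Cochain X Γ n) (θ : Cochain X Γ m) :
    cup h (ω + ω') θ = cup h ω θ + cup h ω' θ := by
  funext σ
  simp [cup, add_mul]

theorem cup_assoc {X Γ : Type*} [TopologicalSpace X] [NonUnitalRing Γ] {n m l a b k : ℕ}
    (h₁ : n + m = a) (h₂ : a + l = k) (h₃ : m + l = b) (h₄ : n + b = k)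
    (ω : Cochain X Γ n) (θ : Cochain X Γ m) (η : Cochain X Γ l) :
    cup h₂ (cup h₁ ω θ) η = cup h₄ ω (cup h₃ θ η) := by
  subst h₁ h₃ h₂
  funext σ
  simp only [cup, SingularSimplex.pull_pull, mul_assoc]
  congr 2
  congr 2
  funext j
  ext
  simp [back, add_assoc]

/-- The Leibniz rule. -/
theorem coboundary_cup {X Γ : Type*} [TopologicalSpace X] [NonUnitalRing Γ] {n m k : ℕ}
    (h : n + m = k) (h₁ : n + 1 + m = k + 1) (h₂ : n + (m + 1) = k + 1)
    (ω : Cochain X Γ n) (θ : Cochain X Γ m) :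
    coboundary k (cup h ω θ) =
      cup h₁ (coboundary n ω) θ + (-1 : ℤ) ^ n • cup h₂ ω (coboundary m θ) := by
  subst h
  funext σ
  -- the term of index `i`, with `i` in one of the two blocks
  have e : (n + 1) + (m + 1) = n + m + 2 := by omega
  have hL : coboundary (n + m) (cup rfl ω θ) σ =
      ∑ i : Fin ((n + 1) + (m + 1)), (-1 : ℤ) ^ (i : ℕ) •
        cup rfl ω θ (σ.pull (Fin.cast e i).succAbove) := by
    simp only [coboundary, AddMonoidHom.coe_mk, ZeroHom.coe_mk]
    exact (Equiv.sum_comp (finCongr e)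
      (fun i : Fin (n + m + 2) => (-1 : ℤ) ^ (i : ℕ) •
        cup rfl ω θ (σ.pull i.succAbove))).symm
  rw [hL, Fin.sum_univ_add]
  have hA : ∀ i : Fin (n + 1),
      cup rfl ω θ (σ.pull (Fin.cast e (Fin.castAdd (m + 1) i)).succAbove) =
        ω ((σ.pull (front h₁)).pull i.castSucc.succAbove) * θ (σ.pull (back h₁)) := by
    intro i
    simp only [cup, SingularSimplex.pull_pull]
    congr 3
    · funext j
      ext
      simp only [front, Function.comp, Fin.succAbove, Fin.lt_def, Fin.val_cast, Fin.val_castAdd,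
        Fin.val_castSucc]
      split_ifs <;> simp
    · funext j
      ext
      simp only [back, Function.comp, Fin.succAbove, Fin.lt_def, Fin.val_cast, Fin.val_castAdd,
        Fin.val_castSucc]
      split_ifs <;> simp <;> omega
  have hB : ∀ i : Fin (m + 1),
      cup rfl ω θ (σ.pull (Fin.cast e (Fin.natAdd (n + 1) i)).succAbove) =
        ω (σ.pull (front h₂)) * θ ((σ.pull (back h₂)).pull i.succ.succAbove) := by
    intro i
    simp only [cup, SingularSimplex.pull_pull]
    congr 3
    · funext j
      ext
      simp only [front, Function.comp, Fin.succAbove, Fin.lt_def, Fin.val_cast, Fin.val_natAdd,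
        Fin.val_castSucc]
      split_ifs <;> simp <;> omega
    · funext j
      ext
      simp only [back, Function.comp, Fin.succAbove, Fin.lt_def, Fin.val_cast, Fin.val_natAdd,
        Fin.val_castSucc, Fin.val_succ]
      split_ifs <;> simp <;> omega
  have hF : (σ.pull (front h₁)).pull (Fin.last (n + 1)).succAbove = σ.pull (front h₂) := by
    rw [SingularSimplex.pull_pull]
    congr 1
    funext j
    ext
    simp [front, Function.comp]
  have hG : (σ.pull (back h₂)).pull (0 : Fin (m + 2)).succAbove = σ.pull (back h₁) := by
    rw [SingularSimplex.pull_pull]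
    congr 1
    funext j
    ext
    simp [back, Function.comp]
    omega
  simp only [hA, hB]
  have hR1 : cup h₁ (coboundary n ω) θ σ =
      (∑ i : Fin (n + 1), (-1 : ℤ) ^ (i : ℕ) •
        (ω ((σ.pull (front h₁)).pull i.castSucc.succAbove) * θ (σ.pull (back h₁)))) +
      (-1 : ℤ) ^ (n + 1) • (ω (σ.pull (front h₂)) * θ (σ.pull (back h₁))) := by
    simp only [cup, coboundary, AddMonoidHom.coe_mk, ZeroHom.coe_mk]
    rw [Fin.sum_univ_castSucc, add_mul, Finset.sum_mul, hF]
    simp only [smul_mul_assoc, Fin.val_castSucc, Fin.val_last]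
  have hR2 : cup h₂ ω (coboundary m θ) σ =
      (ω (σ.pull (front h₂)) * θ (σ.pull (back h₁))) +
      ∑ i : Fin (m + 1), (-1 : ℤ) ^ ((i : ℕ) + 1) •
        (ω (σ.pull (front h₂)) * θ ((σ.pull (back h₂)).pull i.succ.succAbove)) := by
    simp only [cup, coboundary, AddMonoidHom.coe_mk, ZeroHom.coe_mk]
    rw [Fin.sum_univ_succ, mul_add, Finset.mul_sum, hG]
    simp only [mul_smul_comm, Fin.val_succ, Fin.val_zero, pow_zero, one_smul]
  rw [Pi.add_apply, Pi.smul_apply, hR1, hR2, smul_add, Finset.smul_sum]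
  simp only [smul_smul, Fin.val_castAdd, Fin.val_natAdd]
  have hs : ∀ i : Fin (m + 1), (-1 : ℤ) ^ n * (-1 : ℤ) ^ ((i : ℕ) + 1) =
      (-1 : ℤ) ^ (n + 1 + (i : ℕ)) := by
    intro i
    ring
  have ht : (-1 : ℤ) ^ (n + 1) = -(-1 : ℤ) ^ n := by
    ring
  simp only [hs]
  rw [ht, neg_smul]
  abel

/-! ### Measurable cochains and measurable singular cohomology -/

/-- The singular simplex `σ(·, t)`. -/
def slice {X T : Type*} [TopologicalSpace X] [TopologicalSpace T] {n : ℕ}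
    (σ : C(Simplex n × T, X)) (t : T) : SingularSimplex X n :=
  σ.comp ⟨fun s => (s, t), by fun_prop⟩

/-- A singular cochain `ω` is measurable if, for each measurable singular simplex
`σ : Δⁿ × T → X` (an MT-map, where `T` is a standard Borel space with the discrete topology),
the function `t ↦ ω (σ(·, t))` is measurable. (Every standard Borel space is Borel isomorphic to
one in the lowest universe, so `T : Type` loses nothing.) -/
def IsMeasurableCochain {X Γ : Type*} [TopologicalSpace X] [MeasurableSpace X]
    [MeasurableSpace Γ] {n : ℕ} (ω : Cochain X Γ n) : Prop :=
  ∀ (T : Type) [MeasurableSpace T] [StandardBorelSpace T] [TopologicalSpace T]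
    [DiscreteTopology T] (σ : C(Simplex n × T, X)), Measurable σ →
      Measurable fun t => ω (slice σ t)

/-- The composition of a parametrized singular simplex with an affine map of simplices. -/
noncomputable def pullFamily {X T : Type*} [TopologicalSpace X] [TopologicalSpace T] {a b : ℕ}
    (σ : C(Simplex b × T, X)) (f : Fin (a + 1) → Fin (b + 1)) : C(Simplex a × T, X) :=
  σ.comp ⟨fun p => (stdSimplex.map f p.1, p.2),
    ((stdSimplex.continuous_map f).comp continuous_fst).prodMk continuous_snd⟩

theorem measurable_pullFamily {X T : Type*} [TopologicalSpace X] [MeasurableSpace X]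
    [TopologicalSpace T] [MeasurableSpace T] {a b : ℕ} {σ : C(Simplex b × T, X)}
    (hσ : Measurable σ) (f : Fin (a + 1) → Fin (b + 1)) : Measurable (pullFamily σ f) :=
  hσ.comp ((((stdSimplex.continuous_map f).measurable).comp measurable_fst).prodMk measurable_snd)

theorem slice_pull {X T : Type*} [TopologicalSpace X] [TopologicalSpace T] {a b : ℕ}
    (σ : C(Simplex b × T, X)) (f : Fin (a + 1) → Fin (b + 1)) (t : T) :
    (slice σ t).pull f = slice (pullFamily σ f) t := rfl

section Cohomology

variable (X Γ : Type*) [TopologicalSpace X] [MeasurableSpace X]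
  [NonUnitalRing Γ] [MeasurableSpace Γ] [MeasurableAdd₂ Γ] [MeasurableNeg Γ]

/-- The group of measurable singular `n`-cochains. -/
def MTCochain (n : ℕ) : AddSubgroup (Cochain X Γ n) where
  carrier := {ω | IsMeasurableCochain ω}
  zero_mem' := fun _ _ _ _ _ _ _ => measurable_const
  add_mem' := fun h h' T _ _ _ _ σ hσ => (h T σ hσ).add (h' T σ hσ)
  neg_mem' := fun h T _ _ _ _ σ hσ => (h T σ hσ).neg

variable {X Γ} in
theorem coboundary_mem {n : ℕ} {ω : Cochain X Γ n} (hω : ω ∈ MTCochain X Γ n) :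
    coboundary n ω ∈ MTCochain X Γ (n + 1) := by
  intro T _ _ _ _ σ hσ
  simp only [coboundary, AddMonoidHom.coe_mk, ZeroHom.coe_mk, slice_pull]
  exact Finset.measurable_sum _ fun i _ =>
    (hω T _ (measurable_pullFamily hσ i.succAbove)).const_smul ((-1 : ℤ) ^ (i : ℕ))

/-- The coboundary operator of the measurable subcomplex. -/
noncomputable def mtCoboundary (n : ℕ) : MTCochain X Γ n →+ MTCochain X Γ (n + 1) :=
  ((coboundary n).comp (MTCochain X Γ n).subtype).codRestrict (MTCochain X Γ (n + 1))
    fun ω => coboundary_mem ω.2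

/-- Measurable cocycles. -/
noncomputable def cocycles (n : ℕ) : AddSubgroup (MTCochain X Γ n) :=
  (mtCoboundary X Γ n).ker

/-- Measurable coboundaries: coboundaries of measurable cochains (there are no nonzero ones in
degree `0`). -/
noncomputable def coboundaries : (n : ℕ) → AddSubgroup (MTCochain X Γ n)
  | 0 => ⊥
  | n + 1 => (mtCoboundary X Γ n).range

/-- The measurable singular cohomology group: measurable cocycles modulo coboundaries of
measurable cochains. -/
abbrev MTCohomology (n : ℕ) : Type _ :=
  cocycles X Γ n ⧸ (coboundaries X Γ n).addSubgroupOf (cocycles X Γ n)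

variable [MeasurableMul₂ Γ]

variable {X Γ}

theorem cup_mem {n m k : ℕ} (h : n + m = k) {ω : Cochain X Γ n} {θ : Cochain X Γ m}
    (hω : ω ∈ MTCochain X Γ n) (hθ : θ ∈ MTCochain X Γ m) : cup h ω θ ∈ MTCochain X Γ k := by
  intro T _ _ _ _ σ hσ
  simp only [cup, slice_pull]
  exact (hω T _ (measurable_pullFamily hσ _)).mul (hθ T _ (measurable_pullFamily hσ _))

/-- The cup product of measurable cochains. -/
noncomputable def mtCup {n m k : ℕ} (h : n + m = k) (ω : MTCochain X Γ n) (θ : MTCochain X Γ m) :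
    MTCochain X Γ k :=
  ⟨cup h ω.1 θ.1, cup_mem h ω.2 θ.2⟩

theorem mtCup_add {n m k : ℕ} (h : n + m = k) (ω : MTCochain X Γ n) (θ θ' : MTCochain X Γ m) :
    mtCup h ω (θ + θ') = mtCup h ω θ + mtCup h ω θ' :=
  Subtype.ext (cup_add h ω.1 θ.1 θ'.1)

theorem add_mtCup {n m k : ℕ} (h : n + m = k) (ω ω' : MTCochain X Γ n) (θ : MTCochain X Γ m) :
    mtCup h (ω + ω') θ = mtCup h ω θ + mtCup h ω' θ :=
  Subtype.ext (add_cup h ω.1 ω'.1 θ.1)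

/-- The cup product of measurable cochains as a biadditive map. -/
noncomputable def mtCupHom {n m k : ℕ} (h : n + m = k) :
    MTCochain X Γ n →+ MTCochain X Γ m →+ MTCochain X Γ k :=
  AddMonoidHom.mk' (fun ω => AddMonoidHom.mk' (mtCup h ω) (mtCup_add h ω))
    fun ω ω' => AddMonoidHom.ext fun θ => add_mtCup h ω ω' θ

theorem mtCoboundary_mtCup {n m k : ℕ} (h : n + m = k) (h₁ : n + 1 + m = k + 1)
    (h₂ : n + (m + 1) = k + 1) (ω : MTCochain X Γ n) (θ : MTCochain X Γ m) :
    mtCoboundary X Γ k (mtCup h ω θ) =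
      mtCup h₁ (mtCoboundary X Γ n ω) θ + (-1 : ℤ) ^ n • mtCup h₂ ω (mtCoboundary X Γ m θ) :=
  Subtype.ext (coboundary_cup h h₁ h₂ ω.1 θ.1)

theorem mtCup_zero {n m k : ℕ} (h : n + m = k) (ω : MTCochain X Γ n) :
    mtCup h ω (0 : MTCochain X Γ m) = 0 :=
  (mtCupHom h ω).map_zero

theorem zero_mtCup {n m k : ℕ} (h : n + m = k) (θ : MTCochain X Γ m) :
    mtCup h (0 : MTCochain X Γ n) θ = 0 := by
  have := congrArg (fun f => f θ) (mtCupHom (X := X) (Γ := Γ) h).map_zero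
  exact this

theorem mtCup_mem_cocycles {n m k : ℕ} (h : n + m = k) {ω : MTCochain X Γ n}
    {θ : MTCochain X Γ m} (hω : ω ∈ cocycles X Γ n) (hθ : θ ∈ cocycles X Γ m) :
    mtCup h ω θ ∈ cocycles X Γ k := by
  change mtCoboundary X Γ n ω = 0 at hω
  change mtCoboundary X Γ m θ = 0 at hθ
  change mtCoboundary X Γ k (mtCup h ω θ) = 0
  rw [mtCoboundary_mtCup h (by omega) (by omega), hω, hθ, mtCup_zero, zero_mtCup]
  simp

theorem mtCup_mem_coboundaries_left {n m k : ℕ} (h : n + m = k) {ω : MTCochain X Γ n}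
    {θ : MTCochain X Γ m} (hω : ω ∈ coboundaries X Γ n) (hθ : θ ∈ cocycles X Γ m) :
    mtCup h ω θ ∈ coboundaries X Γ k := by
  change mtCoboundary X Γ m θ = 0 at hθ
  cases n with
  | zero =>
    have h0 : ω = 0 := hω
    rw [h0, zero_mtCup]
    exact zero_mem _
  | succ n =>
    obtain ⟨η, rfl⟩ := hω
    obtain ⟨k, rfl⟩ : ∃ l, k = l + 1 := ⟨n + m, by omega⟩
    refine ⟨mtCup (by omega) η θ, ?_⟩
    rw [mtCoboundary_mtCup (by omega) h (by omega), hθ, mtCup_zero, smul_zero, add_zero]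

theorem mtCup_mem_coboundaries_right {n m k : ℕ} (h : n + m = k) {ω : MTCochain X Γ n}
    {θ : MTCochain X Γ m} (hω : ω ∈ cocycles X Γ n) (hθ : θ ∈ coboundaries X Γ m) :
    mtCup h ω θ ∈ coboundaries X Γ k := by
  change mtCoboundary X Γ n ω = 0 at hω
  cases m with
  | zero =>
    have h0 : θ = 0 := hθ
    rw [h0, mtCup_zero]
    exact zero_mem _
  | succ m =>
    obtain ⟨η, rfl⟩ := hθ
    obtain ⟨k, rfl⟩ : ∃ l, k = l + 1 := ⟨n + m, by omega⟩
    have hh : mtCoboundary X Γ k (mtCup (by omega) ω η) =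
        (-1 : ℤ) ^ n • mtCup h ω (mtCoboundary X Γ m η) := by
      rw [mtCoboundary_mtCup (by omega) (by omega) h, hω, zero_mtCup, zero_add]
    refine ⟨(-1 : ℤ) ^ n • mtCup (by omega) ω η, ?_⟩
    rw [map_zsmul, hh, smul_smul, ← mul_pow]
    simp

/-- The cup product of measurable cocycles as a biadditive map. -/
noncomputable def cocycleCup {n m k : ℕ} (h : n + m = k) :
    cocycles X Γ n →+ cocycles X Γ m →+ cocycles X Γ k :=
  AddMonoidHom.mk'
    (fun ω => AddMonoidHom.mk' (fun θ => ⟨mtCup h ω.1 θ.1, mtCup_mem_cocycles h ω.2 θ.2⟩)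
      fun θ θ' => Subtype.ext (mtCup_add h ω.1 θ.1 θ'.1))
    fun ω ω' => AddMonoidHom.ext fun θ => Subtype.ext (add_mtCup h ω.1 ω'.1 θ.1)

/-- The cup product in measurable singular cohomology, `[ω] ⌣ [θ] = [ω ⌣ θ]`. -/
noncomputable def cohomologyCup {n m k : ℕ} (h : n + m = k) :
    MTCohomology X Γ n →+ MTCohomology X Γ m →+ MTCohomology X Γ k :=
  QuotientAddGroup.lift _
    (AddMonoidHom.mk'
      (fun ω => QuotientAddGroup.lift _ ((QuotientAddGroup.mk' _).comp (cocycleCup h ω))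
        fun θ hθ => (QuotientAddGroup.eq_zero_iff _).2 (mtCup_mem_coboundaries_right h ω.2 hθ))
      fun ω ω' => by
        ext θ
        simp
        rfl)
    fun ω hω => by
      ext θ
      exact (QuotientAddGroup.eq_zero_iff _).2 (mtCup_mem_coboundaries_left h hω θ.2)

theorem cohomologyCup_mk {n m k : ℕ} (h : n + m = k) (ω : cocycles X Γ n) (θ : cocycles X Γ m) :
    cohomologyCup h (ω : MTCohomology X Γ n) (θ : MTCohomology X Γ m) =
      ((cocycleCup h ω θ : cocycles X Γ k) : MTCohomology X Γ k) := rfl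

theorem cohomologyCup_assoc {n m l a b k : ℕ}
    (h₁ : n + m = a) (h₂ : a + l = k) (h₃ : m + l = b) (h₄ : n + b = k)
    (x : MTCohomology X Γ n) (y : MTCohomology X Γ m) (z : MTCohomology X Γ l) :
    cohomologyCup h₂ (cohomologyCup h₁ x y) z = cohomologyCup h₄ x (cohomologyCup h₃ y z) := by
  induction x using QuotientAddGroup.induction_on with | H x => ?_
  induction y using QuotientAddGroup.induction_on with | H y => ?_
  induction z using QuotientAddGroup.induction_on with | H z => ?_
  simp only [cohomologyCup_mk]
  congr 1
  exact Subtype.ext (Subtype.ext (cup_assoc h₁ h₂ h₃ h₄ _ _ _))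

variable (X Γ)

noncomputable instance gradedMul :
    DirectSum.GNonUnitalNonAssocSemiring fun n : ℕ+ => MTCohomology X Γ (n : ℕ) where
  mul {i j} x y := cohomologyCup (PNat.add_coe i j).symm x y
  mul_zero x := map_zero _
  zero_mul y := by
    rw [map_zero]
    rfl
  mul_add x y z := map_add _ _ _
  add_mul x y z := by
    rw [map_add]
    rfl

/-- The graded ring `⨁_{n ≥ 1} Hⁿ_MT(X, Γ)` (without unit). -/
abbrev CohomologyRing : Type _ := ⨁ n : ℕ+, MTCohomology X Γ (n : ℕ)

theorem cohomologyRing_mul_assoc (x y z : CohomologyRing X Γ) : x * y * z = x * (y * z) := by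
  induction x using DirectSum.induction_on with
  | zero => simp only [zero_mul]
  | add x x' hx hx' => simp only [add_mul, hx, hx']
  | of i x =>
    induction y using DirectSum.induction_on with
    | zero => simp only [zero_mul, mul_zero]
    | add y y' hy hy' => simp only [add_mul, mul_add, hy, hy']
    | of j y =>
      induction z using DirectSum.induction_on with
      | zero => simp only [mul_zero]
      | add z z' hz hz' => simp only [mul_add, hz, hz']
      | of l z =>
        simp only [DirectSum.of_mul_of]
        have key : ∀ (a b : ℕ+) (hab : a = b) (u : MTCohomology X Γ (a : ℕ))
            (v : MTCohomology X Γ (b : ℕ)),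
            (∀ h : (a : ℕ) = b, (h ▸ u : MTCohomology X Γ (b : ℕ)) = v) →
            DirectSum.of (fun n : ℕ+ => MTCohomology X Γ (n : ℕ)) a u =
              DirectSum.of (fun n : ℕ+ => MTCohomology X Γ (n : ℕ)) b v := by
          intro a b hab u v huv
          subst hab
          rw [← huv rfl]
        refine key _ _ (add_assoc i j l) _ _ fun h => ?_
        have aux : ∀ (a k k' : ℕ) (hk : k = k') (h₂ : a + (l : ℕ) = k) (h₂' : a + (l : ℕ) = k')
            (u : MTCohomology X Γ a),
            (hk ▸ cohomologyCup h₂ u z : MTCohomology X Γ k') = cohomologyCup h₂' u z := by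
          intro a k k' hk h₂ h₂' u
          subst hk
          rfl
        refine (aux _ _ _ h (PNat.add_coe (i + j) l).symm
          (((PNat.add_coe (i + j) l).symm).trans h) _).trans ?_
        exact cohomologyCup_assoc _ _ _ _ x y z

noncomputable instance : NonUnitalRing (CohomologyRing X Γ) :=
  { (inferInstance : AddCommGroup (CohomologyRing X Γ)),
    (inferInstance : NonUnitalNonAssocSemiring (CohomologyRing X Γ)) with
    mul_assoc := cohomologyRing_mul_assoc X Γ }

end Cohomology

/-- The nilpotency order of a ring `R` (without unit): the least `k ≥ 1` such that every product
of `k` elements of `R` vanishes, and `⊤` if there is no such `k`. -/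
noncomputable def nilpotencyOrder (R : Type*) [NonUnitalRing R] : ℕ∞ :=
  sInf {k | ∃ m : ℕ, k = ((m + 1 : ℕ) : ℕ∞) ∧
    ∀ (x : R) (l : List R), l.length = m → l.foldl (· * ·) x = 0}

end MT

/-! This is the Lusternik–Schnirelmann estimate by cup length. Let `U₁, …, Uₖ` be categorical sets
that cover `X`, and let `ω₁, …, ωₖ` be measurable cocycles of positive degrees.

* On `Uᵢ`, the cocycle `ωᵢ` is a coboundary: the prism operator compares `ωᵢ` with its pullback by
  `H(·, 1)`, which maps each leaf of `Uᵢ` to a point, and a cocycle of positive degree that only sees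
  constant simplices has an explicit primitive. Extending the primitive by zero to `X` and
  subtracting its coboundary, one may assume that `ωᵢ` vanishes on the simplices that lie in `Uᵢ`
  (`IsCategorical.exists_coboundary_eq`).
* The product `ω₁ ⌣ ⋯ ⌣ ωₖ` then vanishes on all small simplices, that is, those that lie in some
  `Uᵢ` (`foldl_mul_mem_relativeSubgroup`).
* A measurable cocycle `ω` of positive degree that vanishes on small simplices is the coboundary of a
  measurable cochain. Its primitive at `σ` is the value of `ω` on the homotopy between `σ` and an
  iterated barycentric subdivision of `σ` all of whose simplices are small; the value does not depend
  on the number of subdivisions once it is large enough (`coboundary_smallPrimitive`).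

Measurability enters twice, in the extension by zero and in the number of subdivisions as a function
of the parameter of a family of simplices. In both cases one has to know that, for a measurable
family `σ : Δⁿ × T → X` and a measurable open set `U`, the parameters `t` with `σ(·, t)` in `U` form
a Borel set. As the set `σ⁻¹(U)` is Borel with open sections, this follows from the compactness of
`Δⁿ` and from the Kunugui–Novikov theorem (`measurableSet_forall_mem`), which is deduced from
Novikov's separation theorem for sequences of analytic sets.

Subdivision and prism operators are constructed on chains of tuples of points in a simplex (or in the
product of a simplex and `ℝ`) and are transported to singular cochains by evaluation on the affine
simplices spanned by the tuples. Chains are augmented, which makes the cone operators contracting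
homotopies in all degrees, and both homotopies instances of one recursive construction
(`boundary_comp_homotopy`). -/

namespace MT

/-! ### Borel sets with open sections -/

section OpenSections

open Set MeasureTheory Function

/-- **Novikov's separation theorem**: countably many analytic sets without common point are
contained in Borel sets without common point. If this fails, then it fails as well for some sequence
of pieces of the given sets, however small, and the pieces shrink to points that are not all equal,
hence can be separated by open sets. -/
theorem exists_measurable_superset_iInter_eq_empty {Y : Type*} [TopologicalSpace Y] [T2Space Y]
    [MeasurableSpace Y] [OpensMeasurableSpace Y] {A : ℕ → Set Y} (hA : ∀ n, AnalyticSet (A n))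
    (h : ⋂ n, A n = ∅) :
    ∃ B : ℕ → Set Y, (∀ n, A n ⊆ B n) ∧ (∀ n, MeasurableSet (B n)) ∧ ⋂ n, B n = ∅ := by
  classical
  by_cases h0 : ∃ n, A n = ∅
  · obtain ⟨n, hn⟩ := h0
    refine ⟨fun m => if m = n then ∅ else univ, fun m => ?_, fun m => ?_, ?_⟩
    · by_cases hm : m = n
      · simp [hm, hn]
      · simp [hm]
    · by_cases hm : m = n <;> simp [hm]
    · exact eq_empty_of_forall_notMem fun y hy => by simpa using mem_iInter.1 hy n
  have hA' : ∀ n, ∃ f : (ℕ → ℕ) → Y, Continuous f ∧ range f = A n := fun n => by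
    have := hA n
    rw [AnalyticSet] at this
    exact this.resolve_left fun hn => h0 ⟨n, hn⟩
  choose f hfc hf using hA'
  by_contra hsep
  -- `C x k n` is the image under `f n` of a cylinder; the sequence `x` enumerates, by the pairing
  -- function, the coordinates of a whole sequence of points of `ℕ → ℕ`, of which the first `k`
  -- are prescribed
  let D : (ℕ → ℕ) → ℕ → ℕ → Set (ℕ → ℕ) := fun x k n =>
    {y | ∀ j < k, j.unpair.1 = n → y j.unpair.2 = x j}
  let C : (ℕ → ℕ) → ℕ → ℕ → Set Y := fun x k n => f n '' D x k n
  let Q : ℕ → (ℕ → ℕ) → Prop := fun k x =>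
    ¬ ∃ B : ℕ → Set Y, (∀ n, C x k n ⊆ B n) ∧ (∀ n, MeasurableSet (B n)) ∧ ⋂ n, B n = ∅
  have hDcongr : ∀ x x' k n, (∀ j < k, x j = x' j) → D x k n = D x' k n := by
    intro x x' k n hx
    ext y
    exact forall₂_congr fun j hj => by rw [hx j hj]
  have hQ0 : Q 0 0 := by
    intro hB
    apply hsep
    obtain ⟨B, h1, h2⟩ := hB
    refine ⟨B, fun n => ?_, h2⟩
    rw [← hf n]
    rintro _ ⟨y, rfl⟩
    exact h1 n ⟨y, by simp [D], rfl⟩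
  have hstep : ∀ k x, Q k x → ∃ a, Q (k + 1) (update x k a) := by
    intro k x hx
    by_contra! H
    refine hx ?_
    have H' : ∀ a, ∃ B : ℕ → Set Y, (∀ n, C (update x k a) (k + 1) n ⊆ B n) ∧
        (∀ n, MeasurableSet (B n)) ∧ ⋂ n, B n = ∅ := fun a => not_not.1 (H a)
    choose B hB1 hB2 hB3 using H'
    refine ⟨fun n => if n = k.unpair.1 then ⋃ a, B a n else ⋂ a, B a n, ?_, ?_, ?_⟩
    · rintro n _ ⟨y, hy, rfl⟩
      have key : ∀ a, (n = k.unpair.1 → y k.unpair.2 = a) → f n y ∈ B a n := by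
        intro a ha
        refine hB1 a n ⟨y, fun j hj hjn => ?_, rfl⟩
        rcases Nat.lt_succ_iff_lt_or_eq.1 hj with hj | rfl
        · rw [update_of_ne hj.ne]
          exact hy j hj hjn
        · rw [update_self]
          exact ha hjn.symm
      by_cases hn : n = k.unpair.1
      · simp only [if_pos hn]
        exact mem_iUnion.2 ⟨_, key _ fun _ => rfl⟩
      · simp only [if_neg hn]
        exact mem_iInter.2 fun a => key a fun h => absurd h hn
    · intro n
      by_cases hn : n = k.unpair.1
      · simp only [if_pos hn]
        exact MeasurableSet.iUnion fun a => hB2 a n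
      · simp only [if_neg hn]
        exact MeasurableSet.iInter fun a => hB2 a n
    · refine eq_empty_of_forall_notMem fun y hy => ?_
      rw [mem_iInter] at hy
      have h1 := hy k.unpair.1
      simp only [if_true] at h1
      obtain ⟨a, ha⟩ := mem_iUnion.1 h1
      have : y ∈ ⋂ n, B a n := mem_iInter.2 fun n => by
        by_cases hn : n = k.unpair.1
        · rw [hn]
          exact ha
        · have h2 := hy n
          simp only [if_neg hn] at h2
          exact mem_iInter.1 h2 a
      rw [hB3 a] at this
      exact this
  choose a ha using hstep
  let p : ∀ k, {x // Q k x} := fun k =>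
    Nat.rec ⟨0, hQ0⟩ (fun k x => ⟨update x.1 k (a k x.1 x.2), ha k x.1 x.2⟩) k
  have hp : ∀ k, (p (k + 1)).1 = update (p k).1 k (a k (p k).1 (p k).2) := fun k => rfl
  have hpx : ∀ k, ∀ j < k, (p k).1 j = (p (j + 1)).1 j := by
    intro k j hjk
    induction k, hjk using Nat.le_induction with
    | base => rfl
    | succ k hk ih => rw [hp, update_of_ne (Nat.lt_of_succ_le hk).ne, ih]
  let x : ℕ → ℕ := fun j => (p (j + 1)).1 j
  have hQ : ∀ k, Q k x := by
    intro k
    have := (p k).2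
    simp only [Q, C] at this ⊢
    simpa only [hDcongr x (p k).1 k _ fun j hj => (hpx k j hj).symm] using this
  -- the limit points of the cylinders
  let z : ℕ → ℕ → ℕ := fun n i => x (Nat.pair n i)
  have hne : ∃ n, f n (z n) ≠ f 0 (z 0) := by
    by_contra! hall
    have : f 0 (z 0) ∈ ⋂ n, A n := mem_iInter.2 fun n => by
      rw [← hf n, ← hall n]
      exact mem_range_self _
    rw [h] at this
    exact this
  obtain ⟨n, hn⟩ := hne
  have hn0 : n ≠ 0 := fun h => hn (by rw [h])
  obtain ⟨u, v, hu, hv, hzu, hzv, huv⟩ := t2_separation hn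
  -- a long enough cylinder is mapped into any given neighbourhood of the limit
  have hcyl : ∀ m (w : Set Y), IsOpen w → f m (z m) ∈ w → ∃ k, ∀ k' ≥ k, C x k' m ⊆ w := by
    intro m w hw hz
    obtain ⟨N, hN⟩ := (PiNat.isTopologicalBasis_cylinders (fun _ : ℕ => ℕ)).mem_nhds_iff.1
      ((hw.preimage (hfc m)).mem_nhds hz)
    obtain ⟨⟨y, N, rfl⟩, hzN, hNs⟩ := hN
    rw [← PiNat.mem_cylinder_iff_eq.1 hzN] at hNs
    obtain ⟨k, hk⟩ : ∃ k, ∀ i < N, Nat.pair m i < k := by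
      refine ⟨(Finset.range N).sup (fun i => Nat.pair m i) + 1, fun i hi => ?_⟩
      exact Nat.lt_succ_of_le
        (Finset.le_sup (f := fun i => Nat.pair m i) (Finset.mem_range.2 hi))
    refine ⟨k, ?_⟩
    rintro k' hk' _ ⟨y', hy', rfl⟩
    refine hNs fun i hi => ?_
    have := hy' (Nat.pair m i) ((hk i hi).trans_le hk')
    simpa using this
  obtain ⟨k₁, hk₁⟩ := hcyl n u hu hzu
  obtain ⟨k₂, hk₂⟩ := hcyl 0 v hv hzv
  refine hQ (max k₁ k₂) ⟨fun m => if m = n then u else if m = 0 then v else univ, ?_, ?_, ?_⟩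
  · intro m
    by_cases hm : m = n
    · subst hm
      simpa using hk₁ _ (le_max_left _ _)
    by_cases hm0 : m = 0
    · subst hm0
      simpa [hm] using hk₂ _ (le_max_right _ _)
    · simp [hm, hm0]
  · intro m
    have := hu.measurableSet
    have := hv.measurableSet
    dsimp only
    split_ifs <;> first | assumption | exact MeasurableSet.univ
  · refine eq_empty_of_forall_notMem fun y hy => ?_
    rw [mem_iInter] at hy
    have h1 := hy n
    have h2 := hy 0
    simp only [if_true, if_neg hn0.symm] at h1 h2
    exact disjoint_left.1 huv h1 h2

/-- **Kunugui–Novikov theorem**: a Borel set with open sections is a countable union of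
rectangles with an open and a Borel side. With a basis `V n` of the open sets, `A` is the union of
the sets `V n × {t | V n ⊆ A_t}`, whose second sides are coanalytic; Novikov's theorem shrinks these
rectangles to Borel sets that still cover `A`, and Lusin's theorem then inserts Borel sides. -/
theorem exists_iUnion_prod_eq {K T : Type*} [TopologicalSpace K] [Nonempty K] [PolishSpace K]
    [MeasurableSpace K] [BorelSpace K] [MeasurableSpace T] [StandardBorelSpace T]
    {A : Set (K × T)} (hA : MeasurableSet A) (hop : ∀ t, IsOpen {s | (s, t) ∈ A}) :
    ∃ (V : ℕ → Set K) (B : ℕ → Set T), (∀ n, IsOpen (V n)) ∧ (∀ n, MeasurableSet (B n)) ∧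
      A = ⋃ n, V n ×ˢ B n := by
  let := upgradeStandardBorel T
  obtain ⟨V, hV⟩ : ∃ V : ℕ → Set K, TopologicalSpace.countableBasis K = range V :=
    (TopologicalSpace.countable_countableBasis K).exists_eq_range
      (nonempty_iff_ne_empty.2 fun h => by
        exact empty_ne_univ (by
          simpa [h] using (TopologicalSpace.isBasis_countableBasis K).sUnion_eq))
  have hVo : ∀ n, IsOpen (V n) := fun n =>
    TopologicalSpace.isOpen_of_mem_countableBasis (hV ▸ mem_range_self n)
  -- the complement of the set of all `t` such that `V n` is contained in the section at `t`
  let P : ℕ → Set T := fun n => Prod.snd '' (Aᶜ ∩ V n ×ˢ univ)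
  have hP : ∀ n, AnalyticSet (P n) := fun n =>
    (hA.compl.inter ((hVo n).measurableSet.prod
      MeasurableSet.univ)).analyticSet.image_of_continuous continuous_snd
  have hmem : ∀ n s t, s ∈ V n → t ∉ P n → (s, t) ∈ A := by
    intro n s t hs ht
    by_contra hst
    exact ht ⟨(s, t), ⟨hst, hs, mem_univ _⟩, rfl⟩
  -- the sets `A \ (V n × (P n)ᶜ)` are analytic and have no common point
  obtain ⟨G, hG, hGm, hGe⟩ := exists_measurable_superset_iInter_eq_empty
    (A := fun n => A ∩ (((V n)ᶜ ×ˢ univ) ∪ Prod.snd ⁻¹' (P n)))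
    (fun n => by
      have h1 : AnalyticSet (A ∩ ((V n)ᶜ ×ˢ univ)) :=
        (hA.inter ((hVo n).measurableSet.compl.prod MeasurableSet.univ)).analyticSet
      have h2 : AnalyticSet (A ∩ Prod.snd ⁻¹' (P n)) := by
        rw [inter_eq_iInter]
        refine AnalyticSet.iInter fun b => ?_
        cases b
        · exact (hP n).preimage continuous_snd
        · exact hA.analyticSet
      rw [inter_union_distrib_left, union_eq_iUnion]
      refine AnalyticSet.iUnion fun b => ?_
      cases b
      · exact h2
      · exact h1)
    (by
      refine eq_empty_of_forall_notMem ?_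
      rintro ⟨s, t⟩ hst
      rw [mem_iInter] at hst
      obtain ⟨W, hW, hsW, hWA⟩ := (TopologicalSpace.isBasis_countableBasis K).mem_nhds_iff.1
        ((hop t).mem_nhds (show s ∈ {s | (s, t) ∈ A} from (hst 0).1))
      rw [hV] at hW
      obtain ⟨n, rfl⟩ := hW
      rcases (hst n).2 with h | ⟨⟨s', t'⟩, ⟨h1, h2, -⟩, rfl⟩
      · exact h.1 hsW
      · exact h1 (hWA h2))
  have hE : ∀ n, A \ G n ⊆ V n ×ˢ (P n)ᶜ := by
    rintro n ⟨s, t⟩ ⟨h1, h2⟩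
    by_contra h3
    refine h2 (hG n ⟨h1, ?_⟩)
    by_cases hs : s ∈ V n
    · exact Or.inr (not_not.1 fun ht => h3 ⟨hs, ht⟩)
    · exact Or.inl ⟨hs, mem_univ _⟩
  have hB : ∀ n, ∃ B : Set T, Prod.snd '' (A \ G n) ⊆ B ∧ Disjoint (P n) B ∧ MeasurableSet B := by
    intro n
    refine AnalyticSet.measurablySeparable
      ((hA.diff (hGm n)).analyticSet.image_of_continuous continuous_snd) (hP n) ?_
    rw [disjoint_left]
    rintro _ ⟨p, hp, rfl⟩
    exact (hE n hp).2
  choose B hB1 hB2 hB3 using hB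
  refine ⟨V, B, hVo, hB3, subset_antisymm ?_ ?_⟩
  · rintro ⟨s, t⟩ hst
    have : ¬ (s, t) ∈ ⋂ n, G n := by
      rw [hGe]
      exact notMem_empty _
    obtain ⟨n, hn⟩ := not_forall.1 (mt mem_iInter.2 this)
    exact mem_iUnion.2 ⟨n, (hE n ⟨hst, hn⟩).1, hB1 n ⟨(s, t), ⟨hst, hn⟩, rfl⟩⟩
  · refine iUnion_subset fun n => ?_
    rintro ⟨s, t⟩ ⟨hs, ht⟩
    exact hmem n s t hs fun h => disjoint_left.1 (hB2 n) h ht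

/-- For a Borel set with open sections in a product with a compact space, the full sections are
parametrized by a Borel set. -/
theorem measurableSet_forall_mem {K T : Type*} [TopologicalSpace K] [Nonempty K] [CompactSpace K]
    [PolishSpace K] [MeasurableSpace K] [BorelSpace K] [MeasurableSpace T] [StandardBorelSpace T]
    {A : Set (K × T)} (hA : MeasurableSet A) (hop : ∀ t, IsOpen {s | (s, t) ∈ A}) :
    MeasurableSet {t | ∀ s, (s, t) ∈ A} := by
  obtain ⟨V, B, hV, hB, rfl⟩ := exists_iUnion_prod_eq hA hop
  -- by compactness, finitely many of the rectangles suffice to fill a section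
  have : {t | ∀ s, (s, t) ∈ ⋃ n, V n ×ˢ B n} =
      ⋃ J : {J : Finset ℕ // ⋃ n ∈ J, V n = univ}, ⋂ n ∈ J.1, B n := by
    ext t
    simp only [mem_ofPred_eq, mem_iUnion, mem_iInter, mem_prod]
    constructor
    · intro h
      obtain ⟨J, hJ⟩ := isCompact_univ.elim_finite_subcover
        (fun n : {n // t ∈ B n} => V n) (fun n => hV n) fun s _ => by
          obtain ⟨n, hn, ht⟩ := h s
          exact mem_iUnion.2 ⟨⟨n, ht⟩, hn⟩
      refine ⟨⟨J.map (Embedding.subtype _), ?_⟩, ?_⟩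
      · refine eq_univ_of_forall fun s => ?_
        obtain ⟨n, hn, hs⟩ := mem_iUnion₂.1 (hJ (mem_univ s))
        exact mem_iUnion₂.2 ⟨n, Finset.mem_map_of_mem _ hn, hs⟩
      · intro n hn
        obtain ⟨m, -, rfl⟩ := Finset.mem_map.1 hn
        exact m.2
    · rintro ⟨⟨J, hJ⟩, h⟩ s
      obtain ⟨n, hn, hs⟩ := mem_iUnion₂.1 (hJ.ge (mem_univ s))
      exact ⟨n, hs, h n hn⟩
  rw [this]
  exact MeasurableSet.iUnion fun J => MeasurableSet.biInter J.1.countable_toSet fun n _ => hB n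

end OpenSections

/-! ### Chains of tuples of points -/

/-- Augmented ordered chains on a set of vertices `P`: integral combinations of tuples. The index is
the number of vertices (one more than the dimension), and the empty tuple is a simplex, so that
`boundary P 0` is the augmentation. -/
abbrev TupleChain (P : Type*) (n : ℕ) : Type _ := (Fin n → P) →₀ ℤ

namespace TupleChain

variable {P Q : Type*}

/-- The chain map induced by a map of vertices. -/
noncomputable def map (f : P → Q) (n : ℕ) : TupleChain P n →ₗ[ℤ] TupleChain Q n :=
  Finsupp.lmapDomain ℤ ℤ (f ∘ ·)

@[simp]
theorem map_single (f : P → Q) {n : ℕ} (v : Fin n → P) (a : ℤ) :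
    map f n (Finsupp.single v a) = Finsupp.single (f ∘ v) a :=
  Finsupp.mapDomain_single

/-- The simplicial boundary. -/
noncomputable def boundary (P : Type*) (n : ℕ) : TupleChain P (n + 1) →ₗ[ℤ] TupleChain P n :=
  ∑ i : Fin (n + 1), (-1 : ℤ) ^ (i : ℕ) • Finsupp.lmapDomain ℤ ℤ (· ∘ i.succAbove)

theorem boundary_single {n : ℕ} (v : Fin (n + 1) → P) (a : ℤ) :
    boundary P n (Finsupp.single v a) =
      ∑ i : Fin (n + 1), (-1 : ℤ) ^ (i : ℕ) • Finsupp.single (v ∘ i.succAbove) a := by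
  simp [boundary, Finsupp.mapDomain_single]

theorem map_comp_boundary (f : P → Q) (n : ℕ) :
    map f n ∘ₗ boundary P n = boundary Q n ∘ₗ map f (n + 1) := by
  ext v : 2
  simp only [LinearMap.comp_apply, Finsupp.lsingle_apply, boundary_single, map_single, map_sum,
    map_smul]
  rfl

/-- The cone with apex `b`. -/
noncomputable def cone (b : P) (n : ℕ) : TupleChain P n →ₗ[ℤ] TupleChain P (n + 1) :=
  Finsupp.lmapDomain ℤ ℤ (Fin.cons (α := fun _ => P) b)

theorem cone_single (b : P) {n : ℕ} (v : Fin n → P) (a : ℤ) :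
    cone b n (Finsupp.single v a) =
      Finsupp.single (Fin.cons (α := fun _ => P) b v : Fin (n + 1) → P) a :=
  Finsupp.mapDomain_single

theorem map_cone (f : P → Q) (b : P) {n : ℕ} (c : TupleChain P n) :
    map f (n + 1) (cone b n c) = cone (f b) n (map f n c) := by
  suffices h : map f (n + 1) ∘ₗ cone b n = cone (f b) n ∘ₗ map f n from DFunLike.congr_fun h c
  ext v : 2
  simp only [LinearMap.comp_apply, Finsupp.lsingle_apply, cone_single, map_single]
  congr 1
  exact Fin.comp_cons _ _ _

theorem boundary_cone_zero (b : P) (c : TupleChain P 0) : boundary P 0 (cone b 0 c) = c := by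
  suffices h : boundary P 0 ∘ₗ cone b 0 = LinearMap.id from DFunLike.congr_fun h c
  ext v : 2
  simp [boundary_single, cone_single, Subsingleton.elim _ v]

theorem boundary_cone_succ (b : P) {n : ℕ} (c : TupleChain P (n + 1)) :
    boundary P (n + 1) (cone b (n + 1) c) = c - cone b n (boundary P n c) := by
  suffices h : boundary P (n + 1) ∘ₗ cone b (n + 1) = LinearMap.id - cone b n ∘ₗ boundary P n from
    DFunLike.congr_fun h c
  ext v : 2
  simp only [LinearMap.comp_apply, Finsupp.lsingle_apply, cone_single, boundary_single,
    LinearMap.sub_apply, LinearMap.id_apply, map_sum, map_smul]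
  rw [Fin.sum_univ_succ, sub_eq_add_neg, ← Finset.sum_neg_distrib]
  congr 1
  · simp only [Fin.val_zero, pow_zero, one_smul]
    congr 1
  · refine Finset.sum_congr rfl fun i _ => ?_
    rw [Fin.val_succ, pow_succ, mul_neg_one, neg_smul]
    congr 3
    funext j
    refine Fin.cases ?_ (fun j => ?_) j
    · simp
    · simp

theorem boundary_comp_boundary (n : ℕ) : boundary P n ∘ₗ boundary P (n + 1) = 0 := by
  induction n with
  | zero =>
    ext v : 2
    obtain ⟨b, w, rfl⟩ : ∃ b w, v = Fin.cons b w := ⟨_, _, (Fin.cons_self_tail v).symm⟩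
    simp only [LinearMap.comp_apply, Finsupp.lsingle_apply, ← cone_single]
    simp [boundary_cone_succ, boundary_cone_zero]
  | succ n ih =>
    ext v : 2
    obtain ⟨b, w, rfl⟩ : ∃ b w, v = Fin.cons b w := ⟨_, _, (Fin.cons_self_tail v).symm⟩
    simp only [LinearMap.comp_apply, Finsupp.lsingle_apply, ← cone_single]
    rw [boundary_cone_succ, map_sub, boundary_cone_succ, ← LinearMap.comp_apply (boundary P n), ih]
    simp

/-- The linear map that sends a tuple `v` to the cone of `L v` with apex `β v`. -/
noncomputable def coneOver {n m : ℕ} (β : (Fin n → P) → Q)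
    (L : TupleChain P n →ₗ[ℤ] TupleChain Q m) : TupleChain P n →ₗ[ℤ] TupleChain Q (m + 1) :=
  Finsupp.lsum ℤ fun v => cone (β v) m ∘ₗ L ∘ₗ Finsupp.lsingle v

theorem coneOver_single {n m : ℕ} (β : (Fin n → P) → Q)
    (L : TupleChain P n →ₗ[ℤ] TupleChain Q m) (v : Fin n → P) (a : ℤ) :
    coneOver β L (Finsupp.single v a) = cone (β v) m (L (Finsupp.single v a)) := by
  simp [coneOver]

theorem boundary_comp_coneOver_zero {n : ℕ} (β : (Fin n → P) → Q)
    (L : TupleChain P n →ₗ[ℤ] TupleChain Q 0) : boundary Q 0 ∘ₗ coneOver β L = L := by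
  ext v : 2
  simp only [LinearMap.comp_apply, Finsupp.lsingle_apply, coneOver_single, boundary_cone_zero]

theorem boundary_comp_coneOver_succ {n m : ℕ} (β : (Fin n → P) → Q)
    {L : TupleChain P n →ₗ[ℤ] TupleChain Q (m + 1)} (hL : boundary Q m ∘ₗ L = 0) :
    boundary Q (m + 1) ∘ₗ coneOver β L = L := by
  ext v : 2
  simp only [LinearMap.comp_apply, Finsupp.lsingle_apply, coneOver_single, boundary_cone_succ]
  rw [← LinearMap.comp_apply (boundary Q m), hL]
  simp

theorem map_comp_coneOver {P' Q' : Type*} {n m : ℕ} {φ : P → P'} {ψ : Q → Q'}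
    {β : (Fin n → P) → Q} {β' : (Fin n → P') → Q'} (hβ : ∀ v, ψ (β v) = β' (φ ∘ v))
    {L : TupleChain P n →ₗ[ℤ] TupleChain Q m} {L' : TupleChain P' n →ₗ[ℤ] TupleChain Q' m}
    (hL : map ψ m ∘ₗ L = L' ∘ₗ map φ n) :
    map ψ (m + 1) ∘ₗ coneOver β L = coneOver β' L' ∘ₗ map φ n := by
  ext v : 2
  have := DFunLike.congr_fun hL (Finsupp.single v 1)
  simp only [LinearMap.comp_apply, map_single] at this
  simp only [LinearMap.comp_apply, Finsupp.lsingle_apply, coneOver_single, map_single, map_cone,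
    this, hβ]

/-! ### Chain homotopies and subdivision -/

/-- The chain homotopy between two maps of degree `0`, obtained by coning with apices `β`. -/
noncomputable def homotopy (β : ∀ n, (Fin (n + 1) → P) → Q)
    (F G : ∀ n, TupleChain P n →ₗ[ℤ] TupleChain Q n) :
    ∀ n, TupleChain P n →ₗ[ℤ] TupleChain Q (n + 1)
  | 0 => 0
  | n + 1 => coneOver (β n) (F (n + 1) - G (n + 1) - homotopy β F G n ∘ₗ boundary P n)

/-- Chain maps that agree on the empty tuple are homotopic, since the cones are acyclic. -/
theorem boundary_comp_homotopy (β : ∀ n, (Fin (n + 1) → P) → Q)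
    {F G : ∀ n, TupleChain P n →ₗ[ℤ] TupleChain Q n}
    (hF : ∀ n, F n ∘ₗ boundary P n = boundary Q n ∘ₗ F (n + 1))
    (hG : ∀ n, G n ∘ₗ boundary P n = boundary Q n ∘ₗ G (n + 1)) (h0 : F 0 = G 0) (n : ℕ) :
    boundary Q (n + 1) ∘ₗ homotopy β F G (n + 1) =
      F (n + 1) - G (n + 1) - homotopy β F G n ∘ₗ boundary P n := by
  refine boundary_comp_coneOver_succ _ ?_
  rw [LinearMap.comp_sub, LinearMap.comp_sub, ← hF, ← hG, ← LinearMap.comp_assoc]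
  cases n with
  | zero => simp [homotopy, h0]
  | succ n =>
    rw [boundary_comp_homotopy β hF hG h0 n, LinearMap.sub_comp, LinearMap.sub_comp,
      LinearMap.comp_assoc _ _ (homotopy β F G n), boundary_comp_boundary]
    simp

theorem map_comp_homotopy {P' Q' : Type*} {φ : P → P'} {ψ : Q → Q'}
    {β : ∀ n, (Fin (n + 1) → P) → Q} {β' : ∀ n, (Fin (n + 1) → P') → Q'}
    (hβ : ∀ n v, ψ (β n v) = β' n (φ ∘ v))
    {F G : ∀ n, TupleChain P n →ₗ[ℤ] TupleChain Q n}
    {F' G' : ∀ n, TupleChain P' n →ₗ[ℤ] TupleChain Q' n}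
    (hF : ∀ n, map ψ n ∘ₗ F n = F' n ∘ₗ map φ n) (hG : ∀ n, map ψ n ∘ₗ G n = G' n ∘ₗ map φ n)
    (n : ℕ) :
    map ψ (n + 1) ∘ₗ homotopy β F G n = homotopy β' F' G' n ∘ₗ map φ n := by
  induction n with
  | zero => simp [homotopy]
  | succ n ih =>
    refine map_comp_coneOver (hβ n) ?_
    rw [LinearMap.comp_sub, LinearMap.comp_sub, hF, hG, ← LinearMap.comp_assoc, ih,
      LinearMap.comp_assoc, map_comp_boundary, LinearMap.sub_comp, LinearMap.sub_comp,
      LinearMap.comp_assoc]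

/-- Barycentric subdivision, where `β` assigns to each tuple its barycenter. -/
noncomputable def sd (β : ∀ n, (Fin (n + 1) → P) → P) :
    ∀ n, TupleChain P n →ₗ[ℤ] TupleChain P n
  | 0 => LinearMap.id
  | n + 1 => coneOver (β n) (sd β n ∘ₗ boundary P n)

theorem sd_comp_boundary (β : ∀ n, (Fin (n + 1) → P) → P) (n : ℕ) :
    sd β n ∘ₗ boundary P n = boundary P n ∘ₗ sd β (n + 1) := by
  cases n with
  | zero => exact (boundary_comp_coneOver_zero _ _).symm
  | succ n =>
    refine (boundary_comp_coneOver_succ _ ?_).symm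
    rw [← LinearMap.comp_assoc, ← sd_comp_boundary β n, LinearMap.comp_assoc,
      boundary_comp_boundary, LinearMap.comp_zero]

theorem map_comp_sd {β : ∀ n, (Fin (n + 1) → P) → P} {β' : ∀ n, (Fin (n + 1) → Q) → Q}
    {f : P → Q} (hβ : ∀ n v, f (β n v) = β' n (f ∘ v)) (n : ℕ) :
    map f n ∘ₗ sd β n = sd β' n ∘ₗ map f n := by
  induction n with
  | zero => rfl
  | succ n ih =>
    refine map_comp_coneOver (hβ n) ?_
    rw [← LinearMap.comp_assoc, ih, LinearMap.comp_assoc, map_comp_boundary, LinearMap.comp_assoc]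

/-- The homotopy between the identity and barycentric subdivision. -/
noncomputable def sdHomotopy (β : ∀ n, (Fin (n + 1) → P) → P) :
    ∀ n, TupleChain P n →ₗ[ℤ] TupleChain P (n + 1) :=
  homotopy β (fun _ => LinearMap.id) (sd β)

theorem map_comp_sdHomotopy {β : ∀ n, (Fin (n + 1) → P) → P} {β' : ∀ n, (Fin (n + 1) → Q) → Q}
    {f : P → Q} (hβ : ∀ n v, f (β n v) = β' n (f ∘ v)) (n : ℕ) :
    map f (n + 1) ∘ₗ sdHomotopy β n = sdHomotopy β' n ∘ₗ map f n :=
  map_comp_homotopy hβ (fun _ => rfl) (map_comp_sd hβ) n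

/-- The homotopy between the identity and the `m`-th iterated barycentric subdivision. -/
noncomputable def iterSdHomotopy (β : ∀ n, (Fin (n + 1) → P) → P) (m n : ℕ) :
    TupleChain P n →ₗ[ℤ] TupleChain P (n + 1) :=
  ∑ i ∈ Finset.range m, sdHomotopy β n ∘ₗ sd β n ^ i

theorem sd_pow_comp_boundary (β : ∀ n, (Fin (n + 1) → P) → P) (m n : ℕ) :
    (sd β n ^ m) ∘ₗ boundary P n = boundary P n ∘ₗ (sd β (n + 1) ^ m) := by
  induction m with
  | zero => rfl
  | succ m ih =>
    rw [pow_succ', pow_succ', Module.End.mul_eq_comp, Module.End.mul_eq_comp, LinearMap.comp_assoc,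
      ih, ← LinearMap.comp_assoc, sd_comp_boundary, LinearMap.comp_assoc]

theorem map_comp_sd_pow {β : ∀ n, (Fin (n + 1) → P) → P} {β' : ∀ n, (Fin (n + 1) → Q) → Q}
    {f : P → Q} (hβ : ∀ n v, f (β n v) = β' n (f ∘ v)) (m n : ℕ) :
    map f n ∘ₗ (sd β n ^ m) = (sd β' n ^ m) ∘ₗ map f n := by
  induction m with
  | zero => rfl
  | succ m ih =>
    rw [pow_succ', pow_succ', Module.End.mul_eq_comp, Module.End.mul_eq_comp,
      ← LinearMap.comp_assoc, map_comp_sd hβ, LinearMap.comp_assoc, ih, LinearMap.comp_assoc]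

theorem map_comp_iterSdHomotopy {β : ∀ n, (Fin (n + 1) → P) → P}
    {β' : ∀ n, (Fin (n + 1) → Q) → Q}
    {f : P → Q} (hβ : ∀ n v, f (β n v) = β' n (f ∘ v)) (m n : ℕ) :
    map f (n + 1) ∘ₗ iterSdHomotopy β m n = iterSdHomotopy β' m n ∘ₗ map f n := by
  have h : ∀ i, map f (n + 1) ∘ₗ sdHomotopy β n ∘ₗ (sd β n ^ i) =
      (sdHomotopy β' n ∘ₗ (sd β' n ^ i)) ∘ₗ map f n := fun i => by
    rw [← LinearMap.comp_assoc, map_comp_sdHomotopy hβ, LinearMap.comp_assoc, map_comp_sd_pow hβ,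
      LinearMap.comp_assoc]
  refine LinearMap.ext fun c => ?_
  simp only [iterSdHomotopy, LinearMap.comp_apply, LinearMap.sum_apply, map_sum]
  exact Finset.sum_congr rfl fun i _ => DFunLike.congr_fun (h i) c

theorem boundary_comp_iterSdHomotopy (β : ∀ n, (Fin (n + 1) → P) → P) (m n : ℕ) :
    boundary P (n + 1) ∘ₗ iterSdHomotopy β m (n + 1) =
      LinearMap.id - sd β (n + 1) ^ m - iterSdHomotopy β m n ∘ₗ boundary P n := by
  induction m with
  | zero => simp [iterSdHomotopy, Module.End.one_eq_id]
  | succ m ih =>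
    have h := boundary_comp_homotopy β (F := fun _ => LinearMap.id) (G := sd β) (fun _ => rfl)
      (sd_comp_boundary β) rfl n
    change boundary P (n + 1) ∘ₗ sdHomotopy β (n + 1) =
      LinearMap.id - sd β (n + 1) - sdHomotopy β n ∘ₗ boundary P n at h
    have hs : ∀ k, iterSdHomotopy β (m + 1) k =
        iterSdHomotopy β m k + sdHomotopy β k ∘ₗ sd β k ^ m := fun k => Finset.sum_range_succ _ _
    rw [hs, hs, LinearMap.comp_add, ih, ← LinearMap.comp_assoc, h, LinearMap.add_comp,
      LinearMap.comp_assoc _ _ (sdHomotopy β n), sd_pow_comp_boundary, LinearMap.sub_comp,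
      LinearMap.sub_comp, LinearMap.id_comp, pow_succ', Module.End.mul_eq_comp,
      LinearMap.comp_assoc]
    abel

end TupleChain

/-! ### Affine maps between simplices -/

/-- The combination of the points `v i` with the barycentric coordinates of `x` as weights. -/
noncomputable def combination {E : Type*} [AddCommGroup E] [Module ℝ E] {n : ℕ}
    (v : Fin (n + 1) → E) (x : Simplex n) : E :=
  ∑ i, x i • v i

theorem continuous_combination {E : Type*} [AddCommGroup E] [Module ℝ E] [TopologicalSpace E]
    [ContinuousAdd E] [ContinuousSMul ℝ E] {n : ℕ} (v : Fin (n + 1) → E) :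
    Continuous (combination v) := by
  refine continuous_finsetSum _ fun i _ => Continuous.smul ?_ continuous_const
  exact (continuous_apply i).comp continuous_subtype_val

theorem combination_map {E : Type*} [AddCommGroup E] [Module ℝ E] {a b : ℕ}
    (v : Fin (b + 1) → E) (f : Fin (a + 1) → Fin (b + 1)) (x : Simplex a) :
    combination v (stdSimplex.map f x) = combination (v ∘ f) x := by
  classical
  simp only [combination, stdSimplex.map_coe, FunOnFinite.linearMap_apply_apply, Finset.sum_smul,
    Function.comp_apply]
  rw [← Finset.sum_fiberwise Finset.univ f]
  refine Finset.sum_congr rfl fun j _ => Finset.sum_congr rfl fun i hi => ?_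
  rw [(Finset.mem_filter.1 hi).2]

theorem combination_const {E : Type*} [AddCommGroup E] [Module ℝ E] {n : ℕ} (e : E)
    (x : Simplex n) : combination (fun _ => e) x = e := by
  rw [combination, ← Finset.sum_smul, stdSimplex.sum_eq_one, one_smul]

namespace Simplex

/-- The affine map of simplices that takes the values `v i` at the vertices. -/
noncomputable def affine {n q : ℕ} (v : Fin (n + 1) → Simplex q) (x : Simplex n) : Simplex q :=
  ⟨combination (fun i => (v i : Fin (q + 1) → ℝ)) x,
    (convex_stdSimplex ℝ _).sum_mem (fun i _ => x.2.1 i) x.2.2 fun i _ => (v i).2⟩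

theorem continuous_affine {n q : ℕ} (v : Fin (n + 1) → Simplex q) : Continuous (affine v) :=
  (continuous_combination _).subtype_mk _

theorem affine_map {a b q : ℕ} (v : Fin (b + 1) → Simplex q) (f : Fin (a + 1) → Fin (b + 1))
    (x : Simplex a) : affine v (stdSimplex.map f x) = affine (v ∘ f) x :=
  Subtype.ext (combination_map _ f x)

theorem affine_affine {m n q : ℕ} (v : Fin (n + 1) → Simplex q) (w : Fin (m + 1) → Simplex n)
    (x : Simplex m) : affine v (affine w x) = affine (affine v ∘ w) x := by
  refine Subtype.ext ?_
  change ∑ i, (∑ j, x j • (w j : Fin (n + 1) → ℝ)) i • (v i : Fin (q + 1) → ℝ) =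
    ∑ j, x j • ∑ i, w j i • (v i : Fin (q + 1) → ℝ)
  simp only [Finset.sum_apply, Pi.smul_apply, Finset.sum_smul, Finset.smul_sum, smul_smul,
    smul_eq_mul]
  exact Finset.sum_comm

/-- The tuple of vertices of a simplex. -/
noncomputable def vertices (n : ℕ) : Fin (n + 1) → Simplex n := fun i => stdSimplex.vertex i

theorem affine_vertices {n : ℕ} (x : Simplex n) : affine (vertices n) x = x := by
  refine Subtype.ext ?_
  change ∑ i, x i • (Pi.single i 1 : Fin (n + 1) → ℝ) = _
  exact (pi_eq_sum_univ' (x : Fin (n + 1) → ℝ)).symm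

theorem affine_apply_vertices {n q : ℕ} (v : Fin (n + 1) → Simplex q) (i : Fin (n + 1)) :
    affine v (vertices n i) = v i := by
  refine Subtype.ext ?_
  change ∑ j, (Pi.single i 1 : Fin (n + 1) → ℝ) j • (v j : Fin (q + 1) → ℝ) = _
  simp [Pi.single_apply]
  rfl

theorem affine_comp_vertices {n q : ℕ} (v : Fin (n + 1) → Simplex q) :
    affine v ∘ vertices n = v :=
  funext (affine_apply_vertices v)

theorem map_eq_affine {a b : ℕ} (f : Fin (a + 1) → Fin (b + 1)) (x : Simplex a) :
    stdSimplex.map f x = affine (vertices b ∘ f) x := by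
  rw [← affine_map, affine_vertices]

/-- The barycenter of a tuple of points in a simplex. -/
noncomputable def bary (q n : ℕ) (v : Fin (n + 1) → Simplex q) : Simplex q :=
  affine v stdSimplex.barycenter

theorem affine_bary {p q n : ℕ} (w : Fin (p + 1) → Simplex q) (v : Fin (n + 1) → Simplex p) :
    affine w (bary p n v) = bary q n (affine w ∘ v) :=
  affine_affine _ _ _

theorem dist_affine_le {n q : ℕ} (v : Fin (n + 1) → Simplex q) (x : Simplex n) (y : Simplex q)
    {r : ℝ} (h : ∀ i, dist (v i) y ≤ r) : dist (affine v x) y ≤ r :=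
  (convex_closedBall (y : Fin (q + 1) → ℝ) r).sum_mem (fun i _ => x.2.1 i) x.2.2 fun i _ => h i

theorem dist_bary_le {n q : ℕ} (v : Fin (n + 1) → Simplex q) {δ : ℝ}
    (h : ∀ i j, dist (v i) (v j) ≤ δ) (i : Fin (n + 1)) :
    dist (v i) (bary q n v) ≤ (n / (n + 1)) * δ := by
  have hn : (n + 1 : ℝ) ≠ 0 := by positivity
  have hsum : (v i).1 - (bary q n v).1 =
      ∑ j, (n + 1 : ℝ)⁻¹ • ((v i).1 - (v j).1) := by
    have hb : (bary q n v).1 = ∑ j, (n + 1 : ℝ)⁻¹ • (v j).1 := by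
      change ∑ j, ((Fintype.card (Fin (n + 1)) : ℝ))⁻¹ • (v j).1 = _
      simp
    simp only [smul_sub, Finset.sum_sub_distrib, hb, Finset.sum_const, Finset.card_univ,
      Fintype.card_fin]
    rw [← Nat.cast_smul_eq_nsmul ℝ, smul_smul, Nat.cast_add, Nat.cast_one, mul_inv_cancel₀ hn,
      one_smul]
  rw [Subtype.dist_eq, dist_eq_norm, hsum]
  have hδ : ∀ j, ‖(v i).1 - (v j).1‖ ≤ δ := fun j => by
    rw [← dist_eq_norm]
    exact h i j
  calc _ ≤ ∑ j, ‖(n + 1 : ℝ)⁻¹ • ((v i).1 - (v j).1)‖ := norm_sum_le _ _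
    _ = ∑ j ∈ Finset.univ.erase i, ‖(n + 1 : ℝ)⁻¹ • ((v i).1 - (v j).1)‖ := by
      rw [Finset.sum_erase]
      simp
    _ ≤ ∑ j ∈ Finset.univ.erase i, (n + 1 : ℝ)⁻¹ * δ := by
      refine Finset.sum_le_sum fun j _ => ?_
      rw [norm_smul, Real.norm_of_nonneg (by positivity)]
      exact mul_le_mul_of_nonneg_left (hδ j) (by positivity)
    _ = (n / (n + 1)) * δ := by
      rw [Finset.sum_const, Finset.card_erase_of_mem (Finset.mem_univ _), Finset.card_univ,
        Fintype.card_fin, nsmul_eq_mul, Nat.add_sub_cancel]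
      ring

end Simplex

/-! ### The mesh of iterated subdivisions -/

namespace TupleChain

open Simplex

variable {P : Type*}

theorem mem_of_mem_supported {n : ℕ} {M : Type*} [AddCommGroup M] (L : TupleChain P n →ₗ[ℤ] M)
    {s : Set (Fin n → P)} {N : Submodule ℤ M} (h : ∀ v ∈ s, L (Finsupp.single v 1) ∈ N)
    {c : TupleChain P n} (hc : c ∈ Finsupp.supported ℤ ℤ s) : L c ∈ N := by
  rw [Finsupp.supported_eq_span_single] at hc
  have : Submodule.span ℤ ((fun v => Finsupp.single v (1 : ℤ)) '' s) ≤ N.comap L := by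
    rw [Submodule.span_le]
    rintro _ ⟨v, hv, rfl⟩
    exact h v hv
  exact this hc

theorem boundary_single_mem_supported {n : ℕ} {s : Set (Fin n → P)} {v : Fin (n + 1) → P}
    (h : ∀ i : Fin (n + 1), v ∘ i.succAbove ∈ s) :
    boundary P n (Finsupp.single v 1) ∈ Finsupp.supported ℤ ℤ s := by
  rw [boundary_single]
  exact Submodule.sum_mem _ fun i _ => Submodule.smul_mem _ _
    (Finsupp.single_mem_supported ℤ 1 (h i))

theorem cone_mem_supported {n : ℕ} {s : Set (Fin n → P)} {t : Set (Fin (n + 1) → P)} {b : P}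
    (h : ∀ v ∈ s, (Fin.cons b v : Fin (n + 1) → P) ∈ t)
    {c : TupleChain P n} (hc : c ∈ Finsupp.supported ℤ ℤ s) :
    cone b n c ∈ Finsupp.supported ℤ ℤ t := by
  refine mem_of_mem_supported _ (fun v hv => ?_) hc
  rw [cone_single]
  exact Finsupp.single_mem_supported ℤ 1 (h v hv)

/-- Subdivision does not leave a set of points that is closed under barycenters. -/
theorem sd_mem_supported {β : ∀ n, (Fin (n + 1) → P) → P} {S : Set P}
    (hS : ∀ n v, (∀ i, v i ∈ S) → β n v ∈ S) (n : ℕ) {c : TupleChain P n}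
    (hc : c ∈ Finsupp.supported ℤ ℤ {v | ∀ i, v i ∈ S}) :
    sd β n c ∈ Finsupp.supported ℤ ℤ {v | ∀ i, v i ∈ S} := by
  induction n with
  | zero => exact hc
  | succ n ih =>
    refine mem_of_mem_supported _ (fun v hv => ?_) hc
    rw [sd, coneOver_single]
    refine cone_mem_supported (fun w hw => ?_)
      (ih (boundary_single_mem_supported fun i j => hv (i.succAbove j)))
    exact Fin.cases (hS n v hv) hw

/-- Chains whose simplices have diameter at most `δ`. -/
noncomputable def fine (P : Type*) [Dist P] (δ : ℝ) (n : ℕ) : Submodule ℤ (TupleChain P n) :=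
  Finsupp.supported ℤ ℤ {v | ∀ i j, dist (v i) (v j) ≤ δ}

/-- Subdivision of simplices of dimension at most `N` reduces the diameter by the factor
`N / (N + 1)`. -/
theorem sd_mem_fine {q N n : ℕ} (hn : n ≤ N + 1) {δ : ℝ} (hδ : 0 ≤ δ)
    {c : TupleChain (Simplex q) n} (hc : c ∈ fine (Simplex q) δ n) :
    sd (bary q) n c ∈ fine (Simplex q) (N / (N + 1) * δ) n := by
  induction n with
  | zero => exact fun v _ i => i.elim0
  | succ n ih =>
    refine mem_of_mem_supported _ (fun v hv => ?_) hc
    rw [sd, coneOver_single]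
    set r : ℝ := N / (N + 1) * δ with hr
    have hle : (n / (n + 1) : ℝ) ≤ N / (N + 1) := by
      have : (n : ℝ) ≤ N := by exact_mod_cast Nat.le_of_succ_le_succ hn
      rw [div_le_div_iff₀ (by positivity) (by positivity)]
      nlinarith
    -- the new simplices have diameter at most `r` by induction, except for the edges that end in
    -- the barycenter; the latter are short since all vertices lie in a ball around the barycenter
    have h1 := ih (Nat.le_of_succ_le hn)
      (boundary_single_mem_supported (s := {v | ∀ i j, dist (v i) (v j) ≤ δ}) (v := v)
        fun i j k => hv (i.succAbove j) (i.succAbove k))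
    have h2 := sd_mem_supported (β := bary q) (S := Metric.closedBall (bary q n v) r)
      (fun m w hw => dist_affine_le w _ _ hw) n
      (boundary_single_mem_supported (v := v) fun i j =>
        (dist_bary_le v hv _).trans (mul_le_mul_of_nonneg_right hle hδ))
    have h3 := Submodule.mem_inf.2 ⟨h1, h2⟩
    rw [fine, ← Finsupp.supported_inter] at h3
    refine cone_mem_supported (fun w hw => ?_) h3
    refine Fin.cases (Fin.cases ?_ fun j => ?_) fun i => Fin.cases ?_ fun j => ?_
    · simp only [Fin.cons_zero, dist_self]
      positivity
    · simp only [Fin.cons_zero, Fin.cons_succ]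
      rw [dist_comm]
      exact hw.2 j
    · simp only [Fin.cons_zero, Fin.cons_succ]
      exact hw.2 i
    · simp only [Fin.cons_succ]
      exact hw.1 i j

theorem sd_pow_mem_fine {q n : ℕ} {δ : ℝ} (hδ : 0 ≤ δ)
    {c : TupleChain (Simplex q) (n + 1)} (hc : c ∈ fine (Simplex q) δ (n + 1)) (m : ℕ) :
    (sd (bary q) (n + 1) ^ m) c ∈ fine (Simplex q) ((n / (n + 1)) ^ m * δ) (n + 1) := by
  induction m with
  | zero => simpa using hc
  | succ m ih =>
    rw [pow_succ' (sd (bary q) (n + 1)), Module.End.mul_apply, pow_succ', mul_assoc]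
    exact sd_mem_fine le_rfl (by positivity) ih

/-- The standard simplex as a chain of tuples of its points. -/
noncomputable def fundamental (n : ℕ) : TupleChain (Simplex n) (n + 1) :=
  Finsupp.single (vertices n) 1

/-- Iterated subdivisions are subordinate to any given open cover of the simplex. -/
theorem exists_forall_ge_sd_pow_subset {n : ℕ} {ι : Type*} {c : ι → Set (Simplex n)}
    (hc : ∀ i, IsOpen (c i)) (hcov : ⋃ i, c i = Set.univ) :
    ∃ m, ∀ k ≥ m, ∀ v ∈ ((sd (bary n) (n + 1) ^ k) (fundamental n)).support,
      ∃ i, ∀ s, affine v s ∈ c i := by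
  obtain ⟨δ, hδ, hball⟩ := lebesgue_number_lemma_of_metric isCompact_univ hc hcov.ge
  set D : ℝ := Metric.diam (Set.univ : Set (Simplex n))
  have hD : fundamental n ∈ fine (Simplex n) D (n + 1) :=
    Finsupp.single_mem_supported ℤ 1 fun i j =>
      Metric.dist_le_diam_of_mem isCompact_univ.isBounded (Set.mem_univ _) (Set.mem_univ _)
  have hlim : Filter.Tendsto (fun m : ℕ => ((n : ℝ) / (n + 1)) ^ m * D) Filter.atTop (nhds 0) := by
    have := (tendsto_pow_atTop_nhds_zero_of_lt_one (r := (n : ℝ) / (n + 1)) (by positivity)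
      (by rw [div_lt_one (by positivity)]; linarith)).mul_const D
    simpa using this
  obtain ⟨m, hm⟩ := Filter.eventually_atTop.1 (hlim.eventually (gt_mem_nhds hδ))
  refine ⟨m, fun k hk v hv => ?_⟩
  obtain ⟨i, hi⟩ := hball (v 0) (Set.mem_univ _)
  have hv' := sd_pow_mem_fine Metric.diam_nonneg hD k hv
  exact ⟨i, fun s => hi ((dist_affine_le v s _ fun j => hv' j 0).trans_lt (hm k hk))⟩

end TupleChain

open TupleChain Simplex

/-! ### Evaluation of singular cochains on chains of tuples -/

section Evaluation

variable {X Γ Q : Type*} [TopologicalSpace X] [AddCommGroup Γ]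

/-- The value of the cochain `ω` on a chain of tuples in `Q`, where `Φ` turns tuples into singular
simplices. -/
noncomputable def evaluate {n : ℕ} (ω : Cochain X Γ n)
    (Φ : (Fin (n + 1) → Q) → SingularSimplex X n) : TupleChain Q (n + 1) →ₗ[ℤ] Γ :=
  Finsupp.linearCombination ℤ fun v => ω (Φ v)

theorem evaluate_single {n : ℕ} (ω : Cochain X Γ n)
    (Φ : (Fin (n + 1) → Q) → SingularSimplex X n) (v : Fin (n + 1) → Q) (a : ℤ) :
    evaluate ω Φ (Finsupp.single v a) = a • ω (Φ v) :=
  Finsupp.linearCombination_single _ _ _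

theorem evaluate_map {P : Type*} {n : ℕ} (ω : Cochain X Γ n)
    (Φ : (Fin (n + 1) → Q) → SingularSimplex X n) (f : P → Q) (c : TupleChain P (n + 1)) :
    evaluate ω Φ (TupleChain.map f (n + 1) c) = evaluate ω (fun v => Φ (f ∘ v)) c :=
  Finsupp.linearCombination_mapDomain ℤ _ _

theorem evaluate_boundary {n : ℕ} (ω : Cochain X Γ n)
    {Φ : (Fin (n + 1) → Q) → SingularSimplex X n}
    {Ψ : (Fin (n + 2) → Q) → SingularSimplex X (n + 1)}
    (h : ∀ v i, Φ (v ∘ Fin.succAbove i) = (Ψ v).pull i.succAbove) (c : TupleChain Q (n + 2)) :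
    evaluate ω Φ (boundary Q (n + 1) c) = evaluate (coboundary n ω) Ψ c := by
  suffices h : evaluate ω Φ ∘ₗ boundary Q (n + 1) = evaluate (coboundary n ω) Ψ from
    DFunLike.congr_fun h c
  ext v : 2
  simp [boundary_single, evaluate_single, coboundary, h]

theorem evaluate_eq_zero {n : ℕ} {ω : Cochain X Γ n}
    {Φ : (Fin (n + 1) → Q) → SingularSimplex X n} {c : TupleChain Q (n + 1)}
    (h : ∀ v ∈ c.support, ω (Φ v) = 0) : evaluate ω Φ c = 0 := by
  rw [evaluate, Finsupp.linearCombination_apply]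
  exact Finset.sum_eq_zero fun v hv => (congrArg (c v • ·) (h v hv)).trans (smul_zero _)

theorem measurable_evaluate [MeasurableSpace Γ] [MeasurableAdd₂ Γ] [MeasurableNeg Γ]
    {T : Type*} [MeasurableSpace T] {n : ℕ} {ω : Cochain X Γ n}
    {Φ : T → (Fin (n + 1) → Q) → SingularSimplex X n}
    (h : ∀ v, Measurable fun t => ω (Φ t v)) (c : TupleChain Q (n + 1)) :
    Measurable fun t => evaluate ω (Φ t) c := by
  simp only [evaluate, Finsupp.linearCombination_apply, Finsupp.sum]
  exact Finset.measurable_sum _ fun v _ => (h v).const_smul (c v)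

end Evaluation

/-! ### Affine restrictions of singular simplices -/

section Restrict

variable {X : Type*} [TopologicalSpace X]

/-- The singular simplex `σ` restricted to the affine simplex with vertices `v`. -/
noncomputable def SingularSimplex.restrict {n q : ℕ} (σ : SingularSimplex X q)
    (v : Fin (n + 1) → Simplex q) : SingularSimplex X n :=
  σ.comp ⟨affine v, continuous_affine v⟩

namespace SingularSimplex

theorem restrict_restrict {m n q : ℕ} (σ : SingularSimplex X q)
    (v : Fin (n + 1) → Simplex q) (w : Fin (m + 1) → Simplex n) :
    (σ.restrict v).restrict w = σ.restrict (affine v ∘ w) :=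
  ContinuousMap.ext fun x => congrArg σ (affine_affine v w x)

theorem restrict_pull {m n q : ℕ} (σ : SingularSimplex X q)
    (v : Fin (n + 1) → Simplex q) (f : Fin (m + 1) → Fin (n + 1)) :
    (σ.restrict v).pull f = σ.restrict (v ∘ f) :=
  ContinuousMap.ext fun x => congrArg σ (affine_map v f x)

theorem restrict_vertices {q : ℕ} (σ : SingularSimplex X q) : σ.restrict (vertices q) = σ :=
  ContinuousMap.ext fun x => congrArg σ (affine_vertices x)

theorem pull_eq_restrict {n q : ℕ} (σ : SingularSimplex X q) (f : Fin (n + 1) → Fin (q + 1)) :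
    σ.pull f = σ.restrict (vertices q ∘ f) :=
  ContinuousMap.ext fun x => congrArg σ (map_eq_affine f x)

end SingularSimplex

variable {Γ : Type*} [AddCommGroup Γ]

theorem evaluate_restrict_map {m n q : ℕ} (ω : Cochain X Γ n) (σ : SingularSimplex X q)
    (v : Fin (m + 1) → Simplex q) (c : TupleChain (Simplex m) (n + 1)) :
    evaluate ω σ.restrict (TupleChain.map (affine v) (n + 1) c) =
      evaluate ω (σ.restrict v).restrict c := by
  have h : ((σ.restrict v).restrict : (Fin (n + 1) → Simplex m) → SingularSimplex X n) =
      fun w => σ.restrict (affine v ∘ w) := funext (σ.restrict_restrict v)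
  rw [evaluate_map, h]

theorem evaluate_restrict_boundary {n q : ℕ} (ω : Cochain X Γ n) (σ : SingularSimplex X q)
    (c : TupleChain (Simplex q) (n + 2)) :
    evaluate ω σ.restrict (boundary _ (n + 1) c) = evaluate (coboundary n ω) σ.restrict c :=
  evaluate_boundary ω (fun v _ => (σ.restrict_pull v _).symm) c

theorem coboundary_coboundary {n : ℕ} (ω : Cochain X Γ n) :
    coboundary (n + 1) (coboundary n ω) = 0 := by
  funext σ
  have h := DFunLike.congr_fun (boundary_comp_boundary (n + 1)) (fundamental (n + 2))
  have h' := congrArg (evaluate ω σ.restrict) h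
  rw [LinearMap.comp_apply, evaluate_restrict_boundary, evaluate_restrict_boundary, fundamental,
    evaluate_single, σ.restrict_vertices, one_smul, LinearMap.zero_apply, map_zero] at h'
  exact h'

/-- A natural operator on chains of tuples is determined on tuples by its value on the
fundamental chain. -/
theorem evaluate_restrict_single {k n q : ℕ} (ω : Cochain X Γ n) (σ : SingularSimplex X q)
    {L : ∀ p, TupleChain (Simplex p) (k + 1) →ₗ[ℤ] TupleChain (Simplex p) (n + 1)}
    (hL : ∀ {p r : ℕ} (v : Fin (p + 1) → Simplex r),
      TupleChain.map (affine v) (n + 1) ∘ₗ L p = L r ∘ₗ TupleChain.map (affine v) (k + 1))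
    (v : Fin (k + 1) → Simplex q) :
    evaluate ω σ.restrict (L q (Finsupp.single v 1)) =
      evaluate ω (σ.restrict v).restrict (L k (fundamental k)) := by
  have h := DFunLike.congr_fun (hL v) (fundamental k)
  simp only [LinearMap.comp_apply] at h
  rw [← evaluate_restrict_map, h, fundamental, map_single, affine_comp_vertices]

end Restrict

/-! ### Small simplices -/

/-- Singular simplices that lie in one of the sets of the family `𝒰`. -/
def IsSmall {X : Type*} [TopologicalSpace X] (𝒰 : Set (Set X)) {n : ℕ} (σ : SingularSimplex X n) :
    Prop :=
  ∃ U ∈ 𝒰, ∀ s, σ s ∈ U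

section Small

variable {X : Type*} [TopologicalSpace X] {𝒰 : Set (Set X)}

theorem IsSmall.restrict {n q : ℕ} {σ : SingularSimplex X q} (h : IsSmall 𝒰 σ)
    (v : Fin (n + 1) → Simplex q) : IsSmall 𝒰 (σ.restrict v) := by
  obtain ⟨U, hU, hσ⟩ := h
  exact ⟨U, hU, fun s => hσ _⟩

theorem IsSmall.pull {n q : ℕ} {σ : SingularSimplex X q} (h : IsSmall 𝒰 σ)
    (f : Fin (n + 1) → Fin (q + 1)) : IsSmall 𝒰 (σ.pull f) := by
  rw [σ.pull_eq_restrict]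
  exact h.restrict _

/-- All iterated subdivisions of `σ` from the `m`-th on consist of small simplices. -/
def IsSmallFrom (𝒰 : Set (Set X)) {n : ℕ} (σ : SingularSimplex X n) (m : ℕ) : Prop :=
  ∀ k ≥ m, ∀ v ∈ ((sd (bary n) (n + 1) ^ k) (fundamental n)).support, IsSmall 𝒰 (σ.restrict v)

theorem exists_isSmallFrom (ho : ∀ U ∈ 𝒰, IsOpen U) (hc : ⋃₀ 𝒰 = Set.univ) {n : ℕ}
    (σ : SingularSimplex X n) : ∃ m, IsSmallFrom 𝒰 σ m := by
  obtain ⟨m, hm⟩ := exists_forall_ge_sd_pow_subset (c := fun U : 𝒰 => σ ⁻¹' U.1)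
    (fun U => (ho U.1 U.2).preimage σ.continuous)
    (by rw [← Set.preimage_iUnion, ← Set.sUnion_eq_iUnion, hc, Set.preimage_univ])
  refine ⟨m, fun k hk v hv => ?_⟩
  obtain ⟨U, hU⟩ := hm k hk v hv
  exact ⟨U.1, U.2, hU⟩

open Classical in
/-- The least number of subdivisions after which a singular simplex remains small (`0` if there is
no such number). -/
noncomputable def depth (𝒰 : Set (Set X)) {n : ℕ} (σ : SingularSimplex X n) : ℕ :=
  if h : ∃ m, IsSmallFrom 𝒰 σ m then Nat.find h else 0

theorem isSmallFrom_depth (ho : ∀ U ∈ 𝒰, IsOpen U) (hc : ⋃₀ 𝒰 = Set.univ) {n : ℕ}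
    (σ : SingularSimplex X n) : IsSmallFrom 𝒰 σ (depth 𝒰 σ) := by
  classical
  have h := exists_isSmallFrom ho hc σ
  rw [depth, dif_pos h]
  exact Nat.find_spec h

variable {Γ : Type*} [AddCommGroup Γ]

/-- If `ω` vanishes on small simplices, then the homotopy of iterated subdivisions does not
contribute to the value of `ω` once the subdivisions are small. -/
theorem evaluate_iterSdHomotopy_eq {n : ℕ} {ω : Cochain X Γ (n + 1)}
    (hω : ∀ σ, IsSmall 𝒰 σ → ω σ = 0) {σ : SingularSimplex X n} {m M : ℕ}
    (hm : IsSmallFrom 𝒰 σ m) (hM : m ≤ M) :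
    evaluate ω σ.restrict (iterSdHomotopy (bary n) M (n + 1) (fundamental n)) =
      evaluate ω σ.restrict (iterSdHomotopy (bary n) m (n + 1) (fundamental n)) := by
  induction M, hM using Nat.le_induction with
  | base => rfl
  | succ k hk ih =>
    rw [iterSdHomotopy, Finset.sum_range_succ, LinearMap.add_apply, map_add, ← iterSdHomotopy, ih,
      LinearMap.comp_apply, add_eq_left]
    set c := (sd (bary n) (n + 1) ^ k) (fundamental n) with hc
    have hmem : c ∈ Finsupp.supported ℤ ℤ {v | IsSmall 𝒰 (σ.restrict v)} := hm k hk
    refine (Submodule.mem_bot ℤ).1 (mem_of_mem_supported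
      (evaluate ω σ.restrict ∘ₗ sdHomotopy (bary n) (n + 1)) (fun v hv => ?_) hmem)
    rw [Submodule.mem_bot, LinearMap.comp_apply,
      evaluate_restrict_single ω σ (L := fun p => sdHomotopy (bary p) (n + 1))
        fun w => map_comp_sdHomotopy (fun m u => affine_bary w u) _]
    exact evaluate_eq_zero fun w _ => hω _ (hv.restrict w)

/-- The primitive of a cocycle that vanishes on small simplices: its composition with the homotopy
between the identity and a sufficiently fine subdivision. -/
noncomputable def smallPrimitive (𝒰 : Set (Set X)) {n : ℕ} (ω : Cochain X Γ (n + 1)) :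
    Cochain X Γ n :=
  fun σ => evaluate ω σ.restrict
    (iterSdHomotopy (bary n) (depth 𝒰 σ) (n + 1) (fundamental n))

theorem coboundary_smallPrimitive (ho : ∀ U ∈ 𝒰, IsOpen U) (hc : ⋃₀ 𝒰 = Set.univ) {n : ℕ}
    {ω : Cochain X Γ (n + 1)} (hω : ∀ σ, IsSmall 𝒰 σ → ω σ = 0)
    (hω' : coboundary (n + 1) ω = 0) : coboundary n (smallPrimitive 𝒰 ω) = ω := by
  funext σ
  -- a number of subdivisions that suffices for `σ` and for all of its faces
  obtain ⟨M, hM, hM'⟩ : ∃ M, depth 𝒰 σ ≤ M ∧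
      ∀ i : Fin (n + 2), depth 𝒰 (σ.pull i.succAbove) ≤ M :=
    ⟨max (depth 𝒰 σ) (Finset.univ.sup fun i : Fin (n + 2) => depth 𝒰 (σ.pull i.succAbove)),
      le_max_left _ _, fun i => (Finset.le_sup (f := fun i : Fin (n + 2) =>
        depth 𝒰 (σ.pull i.succAbove)) (Finset.mem_univ i)).trans (le_max_right _ _)⟩
  have hface : ∀ i : Fin (n + 2), smallPrimitive 𝒰 ω (σ.pull i.succAbove) =
      evaluate ω σ.restrict (iterSdHomotopy (bary (n + 1)) M (n + 1)
        (Finsupp.single (vertices (n + 1) ∘ i.succAbove) 1)) := by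
    intro i
    rw [smallPrimitive, ← evaluate_iterSdHomotopy_eq hω (isSmallFrom_depth ho hc _) (hM' i),
      evaluate_restrict_single ω σ (L := fun p => iterSdHomotopy (bary p) M (n + 1))
        fun w => map_comp_iterSdHomotopy (fun m u => affine_bary w u) _ _,
      SingularSimplex.pull_eq_restrict]
  have hsum : coboundary n (smallPrimitive 𝒰 ω) σ = evaluate ω σ.restrict
      (iterSdHomotopy (bary (n + 1)) M (n + 1) (boundary _ (n + 1) (fundamental (n + 1)))) := by
    simp only [coboundary, AddMonoidHom.coe_mk, ZeroHom.coe_mk, hface, fundamental,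
      boundary_single, map_sum, map_smul]
  have hhom := DFunLike.congr_fun
    (boundary_comp_iterSdHomotopy (bary (n + 1)) M (n + 1)) (fundamental (n + 1))
  simp only [LinearMap.comp_apply, LinearMap.sub_apply, LinearMap.id_apply] at hhom
  have hb := congrArg (evaluate ω σ.restrict) hhom
  have hsmall : evaluate ω σ.restrict
      ((sd (bary (n + 1)) (n + 2) ^ M) (fundamental (n + 1))) = 0 :=
    evaluate_eq_zero fun v hv => hω _ (isSmallFrom_depth ho hc σ M hM v hv)
  have hfund : evaluate ω σ.restrict (fundamental (n + 1)) = ω σ := by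
    rw [fundamental, evaluate_single, one_smul, σ.restrict_vertices]
  rw [evaluate_restrict_boundary, hω', map_sub, map_sub, hsmall, hfund, sub_zero,
    evaluate_eq_zero fun _ _ => rfl] at hb
  rw [hsum, ← sub_eq_zero, ← neg_sub, ← hb, neg_zero]

end Small

/-! ### Measurability of the primitive -/

section Measurable

variable {X : Type*} [TopologicalSpace X] [MeasurableSpace X] {𝒰 : Set (Set X)}

/-- The simplices of a measurable family that lie in an open measurable set form a measurable
subfamily. -/
theorem measurableSet_slice_mem {T : Type*} [MeasurableSpace T] [StandardBorelSpace T]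
    [TopologicalSpace T] {U : Set X} (ho : IsOpen U) (hU : MeasurableSet U) {n : ℕ}
    {σ : C(Simplex n × T, X)} (hσ : Measurable σ) : MeasurableSet {t | ∀ s, slice σ t s ∈ U} :=
  measurableSet_forall_mem (hσ hU) fun t => ho.preimage (slice σ t).continuous

/-- The affine restriction of a family of singular simplices. -/
noncomputable def restrictFamily {X T : Type*} [TopologicalSpace X] [TopologicalSpace T]
    {n q : ℕ} (σ : C(Simplex q × T, X))
    (v : Fin (n + 1) → Simplex q) : C(Simplex n × T, X) :=
  σ.comp ⟨fun p => (affine v p.1, p.2),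
    ((continuous_affine v).comp continuous_fst).prodMk continuous_snd⟩

theorem measurable_restrictFamily {T : Type*} [MeasurableSpace T] [TopologicalSpace T] {n q : ℕ}
    {σ : C(Simplex q × T, X)} (hσ : Measurable σ)
    (v : Fin (n + 1) → Simplex q) : Measurable (restrictFamily σ v) :=
  hσ.comp (((continuous_affine v).measurable.comp measurable_fst).prodMk measurable_snd)

theorem measurableSet_isSmall {T : Type*} [MeasurableSpace T] [StandardBorelSpace T]
    [TopologicalSpace T] (hcount : 𝒰.Countable) (ho : ∀ U ∈ 𝒰, IsOpen U)
    (hm : ∀ U ∈ 𝒰, MeasurableSet U) {n : ℕ} {σ : C(Simplex n × T, X)} (hσ : Measurable σ) :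
    MeasurableSet {t | IsSmall 𝒰 (slice σ t)} := by
  have : {t | IsSmall 𝒰 (slice σ t)} = ⋃ U ∈ 𝒰, {t | ∀ s, slice σ t s ∈ U} := by
    ext t
    simp [IsSmall]
  rw [this]
  exact MeasurableSet.biUnion hcount fun U hU => measurableSet_slice_mem (ho U hU) (hm U hU) hσ

theorem measurable_depth {T : Type*} [MeasurableSpace T] [StandardBorelSpace T]
    [TopologicalSpace T] (hcount : 𝒰.Countable) (ho : ∀ U ∈ 𝒰, IsOpen U)
    (hm : ∀ U ∈ 𝒰, MeasurableSet U) (hc : ⋃₀ 𝒰 = Set.univ) {n : ℕ} {σ : C(Simplex n × T, X)}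
    (hσ : Measurable σ) : Measurable fun t => depth 𝒰 (slice σ t) := by
  classical
  have h : ∀ t, ∃ m, IsSmallFrom 𝒰 (slice σ t) m := fun t => exists_isSmallFrom ho hc _
  simp only [depth, h, dif_pos]
  refine measurable_find h fun m => ?_
  simp only [IsSmallFrom, Set.ofPred_forall]
  refine MeasurableSet.iInter fun k => MeasurableSet.iInter fun _ =>
    MeasurableSet.biInter (Finset.countable_toSet _) fun v _ => ?_
  exact measurableSet_isSmall hcount ho hm (measurable_restrictFamily hσ v)

theorem isMeasurableCochain_smallPrimitive {Γ : Type*} [AddCommGroup Γ] [MeasurableSpace Γ]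
    [MeasurableAdd₂ Γ] [MeasurableNeg Γ] (hcount : 𝒰.Countable) (ho : ∀ U ∈ 𝒰, IsOpen U)
    (hm : ∀ U ∈ 𝒰, MeasurableSet U) (hc : ⋃₀ 𝒰 = Set.univ) {n : ℕ} {ω : Cochain X Γ (n + 1)}
    (hω : IsMeasurableCochain ω) : IsMeasurableCochain (smallPrimitive 𝒰 ω) := by
  intro T _ _ _ _ σ hσ
  have hF : ∀ m : ℕ, Measurable fun t : T => evaluate ω (slice σ t).restrict
      (iterSdHomotopy (bary n) m (n + 1) (fundamental n)) := fun m =>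
    measurable_evaluate (fun v => hω T _ (measurable_restrictFamily hσ v)) _
  have hF' : Measurable fun p : T × ℕ => evaluate ω (slice σ p.1).restrict
      (iterSdHomotopy (bary n) p.2 (n + 1) (fundamental n)) :=
    measurable_from_prod_countable_left hF
  have hd := measurable_depth hcount ho hm hc hσ
  have h := hF'.comp (measurable_id'.prodMk hd)
  exact h

end Measurable

/-! ### Extension of measurable cochains by zero -/

section Extend

variable {X Γ : Type*} [TopologicalSpace X] [AddCommGroup Γ] {U : Set X}

/-- A singular simplex of a subspace, regarded as a singular simplex of the ambient space. -/
def SingularSimplex.incl {n : ℕ} (τ : SingularSimplex U n) : SingularSimplex X n :=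
  ⟨fun s => τ s, continuous_subtype_val.comp τ.continuous⟩

open Classical in
/-- The extension by zero of a cochain of a subspace: it vanishes on the singular simplices that do
not lie in the subspace. -/
noncomputable def extendByZero {n : ℕ} (η : Cochain U Γ n) : Cochain X Γ n :=
  fun σ => if h : ∀ s, σ s ∈ U then η ⟨fun s => ⟨σ s, h s⟩, σ.continuous.subtype_mk h⟩ else 0

theorem extendByZero_incl {n : ℕ} (η : Cochain U Γ n) (τ : SingularSimplex U n) :
    extendByZero η τ.incl = η τ :=
  dif_pos fun s => (τ s).2

theorem coboundary_extendByZero_incl {n : ℕ} (η : Cochain U Γ n)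
    (τ : SingularSimplex U (n + 1)) :
    coboundary n (extendByZero η) τ.incl = coboundary n η τ := by
  simp only [coboundary, AddMonoidHom.coe_mk, ZeroHom.coe_mk]
  exact Finset.sum_congr rfl fun i _ => congrArg _ (extendByZero_incl η (τ.pull i.succAbove))

theorem isMeasurableCochain_extendByZero [MeasurableSpace X] [MeasurableSpace Γ]
    (ho : IsOpen U) (hU : MeasurableSet U) {n : ℕ} {η : Cochain U Γ n}
    (hη : IsMeasurableCochain η) : IsMeasurableCochain (extendByZero η) := by
  intro T _ _ _ _ σ hσ
  set S : Set T := {t | ∀ s, slice σ t s ∈ U} with hSdef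
  have hS : MeasurableSet S := measurableSet_slice_mem ho hU hσ
  have := hS.standardBorel
  let τ : C(Simplex n × S, U) :=
    ⟨fun p => ⟨σ (p.1, p.2.1), p.2.2 p.1⟩, Continuous.subtype_mk (σ.continuous.comp
      (continuous_fst.prodMk (continuous_subtype_val.comp continuous_snd))) _⟩
  have hτ : Measurable τ := Measurable.subtype_mk
    (hσ.comp (measurable_fst.prodMk (measurable_subtype_coe.comp measurable_snd)))
  refine measurable_of_restrict_of_restrict_compl hS ?_ ?_
  · have h : S.domRestrict (fun t => extendByZero η (slice σ t)) = fun t => η (slice τ t) :=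
      funext fun t => extendByZero_incl η (slice τ t)
    rw [h]
    exact hη S τ hτ
  · have h : Sᶜ.domRestrict (fun t => extendByZero η (slice σ t)) = fun _ => 0 :=
      funext fun t => dif_neg t.2
    rw [h]
    exact measurable_const

end Extend

/-! ### Cocycles on categorical sets -/

section Homotopy

/-- The prism operator: the chain homotopy between the two ends of the cylinder `P × ℝ`. -/
noncomputable def prism (P : Type*) :
    ∀ n, TupleChain P n →ₗ[ℤ] TupleChain (P × ℝ) (n + 1) :=
  homotopy (fun _ v => (v 0, 0)) (TupleChain.map (·, 1)) (TupleChain.map (·, 0))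

theorem boundary_comp_prism (P : Type*) (n : ℕ) :
    boundary (P × ℝ) (n + 1) ∘ₗ prism P (n + 1) =
      TupleChain.map (·, 1) (n + 1) - TupleChain.map (·, 0) (n + 1) - prism P n ∘ₗ boundary P n :=
  boundary_comp_homotopy _ (map_comp_boundary _) (map_comp_boundary _)
    (Finsupp.lhom_ext' fun v => LinearMap.ext_ring (by simp)) n

theorem map_comp_prism {P Q : Type*} (f : P → Q) (n : ℕ) :
    TupleChain.map (Prod.map f id) (n + 1) ∘ₗ prism P n = prism Q n ∘ₗ TupleChain.map f n :=
  map_comp_homotopy (fun _ _ => rfl)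
    (fun _ => Finsupp.lhom_ext' fun v => LinearMap.ext_ring (by simp; rfl))
    (fun _ => Finsupp.lhom_ext' fun v => LinearMap.ext_ring (by simp; rfl)) n

variable {Y X : Type*} [TopologicalSpace Y] [TopologicalSpace X]

/-- The restriction of the cylinder `H ∘ (τ × id)` over a singular simplex `τ` to the affine simplex
with vertices `w`. -/
noncomputable def cylinderSimplex (H : C(Y × ℝ, X)) {n q : ℕ} (τ : SingularSimplex Y q)
    (w : Fin (n + 1) → Simplex q × ℝ) : SingularSimplex X n :=
  H.comp ⟨fun s => (τ (affine (fun i => (w i).1) s), combination (fun i => (w i).2) s),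
    (τ.continuous.comp (continuous_affine _)).prodMk (continuous_combination _)⟩

theorem cylinderSimplex_pull (H : C(Y × ℝ, X)) {m n q : ℕ} (τ : SingularSimplex Y q)
    (w : Fin (n + 1) → Simplex q × ℝ) (f : Fin (m + 1) → Fin (n + 1)) :
    (cylinderSimplex H τ w).pull f = cylinderSimplex H τ (w ∘ f) :=
  ContinuousMap.ext fun s =>
    congrArg H (Prod.ext (congrArg τ (affine_map _ f s)) (combination_map _ f s))

theorem cylinderSimplex_restrict (H : C(Y × ℝ, X)) {m n q : ℕ} (τ : SingularSimplex Y q)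
    (v : Fin (m + 1) → Simplex q) (w : Fin (n + 1) → Simplex m × ℝ) :
    cylinderSimplex H (τ.restrict v) w = cylinderSimplex H τ (Prod.map (affine v) id ∘ w) :=
  ContinuousMap.ext fun s => congrArg H (Prod.ext (congrArg τ (affine_affine _ _ s)) rfl)

/-- The singular simplex `H(τ(·), r)`. -/
def levelSimplex (H : C(Y × ℝ, X)) {q : ℕ} (τ : SingularSimplex Y q) (r : ℝ) :
    SingularSimplex X q :=
  H.comp ⟨fun s => (τ s, r), τ.continuous.prodMk continuous_const⟩

theorem cylinderSimplex_vertices (H : C(Y × ℝ, X)) {q : ℕ} (τ : SingularSimplex Y q) (r : ℝ) :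
    cylinderSimplex H τ ((·, r) ∘ vertices q) = levelSimplex H τ r :=
  ContinuousMap.ext fun s =>
    congrArg H (Prod.ext (congrArg τ (affine_vertices s)) (combination_const r s))

variable {Γ : Type*} [AddCommGroup Γ]

/-- The cochain obtained from `ω` by a homotopy `H` and the prism operator. -/
noncomputable def prismCochain (H : C(Y × ℝ, X)) {q : ℕ} (ω : Cochain X Γ (q + 1)) :
    Cochain Y Γ q :=
  fun τ => evaluate ω (cylinderSimplex H τ) (prism _ (q + 1) (fundamental q))

/-- The homotopy formula for singular cocycles. -/
theorem coboundary_prismCochain (H : C(Y × ℝ, X)) {q : ℕ} {ω : Cochain X Γ (q + 1)}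
    (hω : coboundary (q + 1) ω = 0) (τ : SingularSimplex Y (q + 1)) :
    coboundary q (prismCochain H ω) τ = ω (levelSimplex H τ 1) - ω (levelSimplex H τ 0) := by
  have hface : ∀ i : Fin (q + 2), prismCochain H ω (τ.pull i.succAbove) =
      evaluate ω (cylinderSimplex H τ)
        (prism _ (q + 1) (Finsupp.single (vertices (q + 1) ∘ i.succAbove) 1)) := by
    intro i
    have h := DFunLike.congr_fun (map_comp_prism (affine (vertices (q + 1) ∘ i.succAbove)) (q + 1))
      (fundamental q)
    simp only [LinearMap.comp_apply] at h
    rw [fundamental, map_single, affine_comp_vertices] at h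
    rw [← h, evaluate_map, prismCochain, SingularSimplex.pull_eq_restrict]
    congr 2
    exact funext (cylinderSimplex_restrict H τ _)
  have hsum : coboundary q (prismCochain H ω) τ = evaluate ω (cylinderSimplex H τ)
      (prism _ (q + 1) (boundary _ (q + 1) (fundamental (q + 1)))) := by
    simp only [coboundary, AddMonoidHom.coe_mk, ZeroHom.coe_mk, hface, fundamental,
      boundary_single, map_sum, map_smul]
  have hhom := DFunLike.congr_fun (boundary_comp_prism (Simplex (q + 1)) (q + 1))
    (fundamental (q + 1))
  simp only [LinearMap.comp_apply, LinearMap.sub_apply] at hhom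
  have hb := congrArg (evaluate ω (cylinderSimplex H τ)) hhom
  rw [evaluate_boundary ω fun v i => (cylinderSimplex_pull H τ v i.succAbove).symm, hω, map_sub,
    map_sub, evaluate_eq_zero fun _ _ => rfl, ← hsum, fundamental, map_single, map_single,
    evaluate_single, evaluate_single, one_smul, one_smul, cylinderSimplex_vertices,
    cylinderSimplex_vertices] at hb
  exact (sub_eq_zero.1 hb.symm).symm

/-- The cochain that evaluates `ω` on the constant simplices at the points `H(τ(v₀), 1)`. -/
noncomputable def constCochain {Γ : Type*} (H : C(Y × ℝ, X)) {q : ℕ} (ω : Cochain X Γ (q + 1)) :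
    Cochain Y Γ q :=
  fun τ => ω (ContinuousMap.const _ (H (τ (vertices q 0), 1)))

/-- If `H(·, 1)` is constant on connected components, then its pullback of a cocycle of positive degree
is a coboundary: `H(·, 1)` maps simplices to constant simplices. -/
theorem coboundary_constCochain {H : C(Y × ℝ, X)}
    (hH : ∀ x y : Y, y ∈ connectedComponent x → H (y, 1) = H (x, 1)) {q : ℕ}
    {ω : Cochain X Γ (q + 1)} (hω : coboundary (q + 1) ω = 0) (τ : SingularSimplex Y (q + 1)) :
    coboundary q (constCochain H ω) τ = ω (levelSimplex H τ 1) := by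
  set x := H (τ (vertices (q + 1) 0), 1) with hx
  have hτ : ∀ s, H (τ s, 1) = x := fun s =>
    hH _ _ ((isPreconnected_range τ.continuous).subset_connectedComponent
      (Set.mem_range_self _) (Set.mem_range_self s))
  have hlevel : levelSimplex H τ 1 = ContinuousMap.const _ x := ContinuousMap.ext hτ
  set a := ω (ContinuousMap.const _ x) with ha
  -- the alternating sums over the faces of a constant `(q + 2)`- and `(q + 1)`-simplex differ by
  -- one term, and the former vanishes
  have h2 : ∑ i : Fin (q + 3), (-1 : ℤ) ^ (i : ℕ) • a = 0 :=
    congrFun hω (ContinuousMap.const _ x)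
  have h1 : coboundary q (constCochain H ω) τ = ∑ i : Fin (q + 2), (-1 : ℤ) ^ (i : ℕ) • a := by
    simp only [coboundary, AddMonoidHom.coe_mk, ZeroHom.coe_mk]
    refine Finset.sum_congr rfl fun i _ => congrArg _ ?_
    exact congrArg (fun z => ω (ContinuousMap.const _ z)) (hτ _)
  rw [Fin.sum_univ_succ] at h2
  simp only [Fin.val_zero, pow_zero, one_smul, Fin.val_succ, pow_succ, mul_neg_one, neg_smul,
    Finset.sum_neg_distrib, ← h1] at h2
  rw [hlevel, ← ha]
  exact (sub_eq_zero.1 ((sub_eq_add_neg _ _).trans h2)).symm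

variable [MeasurableSpace X] [MeasurableSpace Y]

theorem isMeasurableCochain_constCochain {Γ : Type*} [MeasurableSpace Γ] {H : C(Y × ℝ, X)}
    (hH : Measurable H) {q : ℕ} {ω : Cochain X Γ (q + 1)} (hω : IsMeasurableCochain ω) :
    IsMeasurableCochain (constCochain H ω) := by
  intro T _ _ _ _ τ hτ
  let σ : C(Simplex (q + 1) × T, X) := H.comp
    ⟨fun p => (τ (vertices q 0, p.2), 1), by fun_prop⟩
  have hσ : Measurable σ := hH.comp
    ((hτ.comp (measurable_const.prodMk measurable_snd)).prodMk measurable_const)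
  exact hω T σ hσ

variable [MeasurableSpace Γ]

theorem isMeasurableCochain_prismCochain [MeasurableAdd₂ Γ] [MeasurableNeg Γ]
    {H : C(Y × ℝ, X)} (hH : Measurable H) {q : ℕ}
    {ω : Cochain X Γ (q + 1)} (hω : IsMeasurableCochain ω) :
    IsMeasurableCochain (prismCochain H ω) := by
  intro T _ _ _ _ τ hτ
  refine measurable_evaluate (fun w => ?_) _
  let σ : C(Simplex (q + 1) × T, X) := H.comp
    ⟨fun p => (τ (affine (fun i => (w i).1) p.1, p.2), combination (fun i => (w i).2) p.1),
      (τ.continuous.comp (((continuous_affine _).comp continuous_fst).prodMk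
        continuous_snd)).prodMk ((continuous_combination _).comp continuous_fst)⟩
  have hσ : Measurable σ := hH.comp
    ((hτ.comp (((continuous_affine _).measurable.comp measurable_fst).prodMk
      measurable_snd)).prodMk ((continuous_combination _).measurable.comp measurable_fst))
  exact hω T σ hσ

/-- In positive degrees, measurable cocycles are coboundaries on categorical sets, and the primitive
can be chosen to be defined on the ambient space. -/
theorem IsCategorical.exists_coboundary_eq [MeasurableAdd₂ Γ] [MeasurableNeg Γ] {U : Set X}
    (hU : IsCategorical U) {q : ℕ} {ω : Cochain X Γ (q + 1)} (hω : IsMeasurableCochain ω)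
    (hω' : coboundary (q + 1) ω = 0) :
    ∃ η : Cochain X Γ q, IsMeasurableCochain η ∧
      ∀ σ : SingularSimplex X (q + 1), (∀ s, σ s ∈ U) → coboundary q η σ = ω σ := by
  obtain ⟨H, hH⟩ := hU.exists_contraction
  let H' : C(U × ℝ, X) := ⟨H, hH.isMTMap.continuous⟩
  have hH' : Measurable H' := hH.isMTMap.measurable
  refine ⟨extendByZero (constCochain H' ω - prismCochain H' ω),
    isMeasurableCochain_extendByZero hU.isOpen hU.measurableSet ?_, fun σ hσ => ?_⟩
  · intro T _ _ _ _ τ hτ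
    exact (isMeasurableCochain_constCochain hH' hω T τ hτ).sub
      (isMeasurableCochain_prismCochain hH' hω T τ hτ)
  · let τ : SingularSimplex U (q + 1) := ⟨fun s => ⟨σ s, hσ s⟩, σ.continuous.subtype_mk hσ⟩
    have h0 : levelSimplex H' τ 0 = σ := ContinuousMap.ext fun s => hH.map_zero _
    have h := coboundary_extendByZero_incl (constCochain H' ω - prismCochain H' ω) τ
    rw [map_sub, Pi.sub_apply, coboundary_constCochain hH.map_one hω',
      coboundary_prismCochain H' hω', h0, sub_sub_cancel] at h
    exact h

end Homotopy

/-! ### Cohomology classes relative to a family of sets -/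

section Relative

variable {X Γ : Type*} [TopologicalSpace X] [MeasurableSpace X] [NonUnitalRing Γ]
  [MeasurableSpace Γ] [MeasurableAdd₂ Γ] [MeasurableNeg Γ]

/-- The measurable cohomology classes that are represented by a cocycle that vanishes on the
singular simplices lying in one of the sets of the family `𝒱`. -/
noncomputable def relativeClasses (Γ : Type*) [NonUnitalRing Γ] [MeasurableSpace Γ]
    [MeasurableAdd₂ Γ] [MeasurableNeg Γ] (𝒱 : Set (Set X)) (n : ℕ) : AddSubgroup (MTCohomology X Γ n) :=
  AddSubgroup.map (QuotientAddGroup.mk' _)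
    { carrier := {ω : cocycles X Γ n | ∀ σ, IsSmall 𝒱 σ → ω.1.1 σ = 0}
      zero_mem' := fun _ _ => rfl
      add_mem' := fun {ω θ} hω hθ σ hσ => by
        change ω.1.1 σ + θ.1.1 σ = 0
        rw [hω σ hσ, hθ σ hσ, add_zero]
      neg_mem' := fun {ω} hω σ hσ => by
        change -ω.1.1 σ = 0
        rw [hω σ hσ, neg_zero] }

theorem mk_mem_relativeClasses {𝒱 : Set (Set X)} {n : ℕ} {ω : cocycles X Γ n}
    (h : ∀ σ, IsSmall 𝒱 σ → ω.1.1 σ = 0) :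
    (ω : MTCohomology X Γ n) ∈ relativeClasses Γ 𝒱 n :=
  ⟨ω, h, rfl⟩

/-- Every class of positive degree restricts to zero on a categorical set. -/
theorem IsCategorical.mem_relativeClasses {U : Set X} (hU : IsCategorical U) {n : ℕ}
    (hn : 0 < n) (x : MTCohomology X Γ n) : x ∈ relativeClasses Γ {U} n := by
  induction x using QuotientAddGroup.induction_on with | H ω => ?_
  obtain ⟨n, rfl⟩ : ∃ m, n = m + 1 := Nat.exists_eq_add_one.2 hn
  obtain ⟨η, hη, hηω⟩ := hU.exists_coboundary_eq ω.1.2 (congrArg Subtype.val ω.2)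
  let θ : cocycles X Γ (n + 1) := ⟨mtCoboundary X Γ n ⟨η, hη⟩,
    Subtype.ext (coboundary_coboundary η)⟩
  have hmk : (ω : MTCohomology X Γ (n + 1)) = ((ω - θ : cocycles X Γ (n + 1)) : _) := by
    refine QuotientAddGroup.eq.2 ?_
    rw [AddSubgroup.mem_addSubgroupOf]
    refine ⟨-⟨η, hη⟩, ?_⟩
    rw [map_neg]
    simp [θ, sub_eq_add_neg]
  rw [hmk]
  refine mk_mem_relativeClasses fun σ hσ => ?_
  obtain ⟨_, rfl, hσ⟩ := hσ
  exact sub_eq_zero.2 (hηω σ hσ).symm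

/-- Relative classes of an open cover are trivial. -/
theorem eq_zero_of_mem_relativeClasses {𝒰 : Set (Set X)} (hcount : 𝒰.Countable)
    (ho : ∀ U ∈ 𝒰, IsOpen U) (hm : ∀ U ∈ 𝒰, MeasurableSet U) (hc : ⋃₀ 𝒰 = Set.univ) {n : ℕ}
    (hn : 0 < n) {x : MTCohomology X Γ n} (hx : x ∈ relativeClasses Γ 𝒰 n) : x = 0 := by
  obtain ⟨ω, hω, rfl⟩ := hx
  obtain ⟨n, rfl⟩ : ∃ m, n = m + 1 := Nat.exists_eq_add_one.2 hn
  refine (QuotientAddGroup.eq_zero_iff _).2 ?_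
  rw [AddSubgroup.mem_addSubgroupOf]
  exact ⟨⟨smallPrimitive 𝒰 ω.1.1, isMeasurableCochain_smallPrimitive hcount ho hm hc ω.1.2⟩,
    Subtype.ext (coboundary_smallPrimitive ho hc hω (congrArg Subtype.val ω.2))⟩

/-- The elements of the cohomology ring all of whose components are classes relative to `𝒱`. -/
noncomputable def relativeSubgroup (Γ : Type*) [NonUnitalRing Γ] [MeasurableSpace Γ]
    [MeasurableAdd₂ Γ] [MeasurableNeg Γ] (𝒱 : Set (Set X)) : AddSubgroup (CohomologyRing X Γ) where
  carrier := {x | ∀ n : ℕ+, x n ∈ relativeClasses Γ 𝒱 n}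
  zero_mem' := fun _ => zero_mem _
  add_mem' := fun hx hy n => add_mem (hx n) (hy n)
  neg_mem' := fun hx n => neg_mem (hx n)

theorem of_mem_relativeSubgroup {𝒱 : Set (Set X)} {n : ℕ+} {z : MTCohomology X Γ (n : ℕ)}
    (hz : z ∈ relativeClasses Γ 𝒱 n) :
    DirectSum.of (fun n : ℕ+ => MTCohomology X Γ (n : ℕ)) n z ∈ relativeSubgroup Γ 𝒱 := by
  intro k
  by_cases hk : n = k
  · subst hk
    rwa [DirectSum.of_eq_same]
  · rw [DirectSum.of_eq_of_ne _ _ _ (Ne.symm hk)]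
    exact zero_mem _

theorem IsCategorical.mem_relativeSubgroup {U : Set X} (hU : IsCategorical U)
    (x : CohomologyRing X Γ) : x ∈ relativeSubgroup Γ {U} :=
  fun n => hU.mem_relativeClasses n.pos _

variable [MeasurableMul₂ Γ]

theorem cohomologyCup_mem_relativeClasses {𝒱 𝒲 : Set (Set X)} {n m k : ℕ} (h : n + m = k)
    {x : MTCohomology X Γ n} {y : MTCohomology X Γ m} (hx : x ∈ relativeClasses Γ 𝒱 n)
    (hy : y ∈ relativeClasses Γ 𝒲 m) : cohomologyCup h x y ∈ relativeClasses Γ (𝒱 ∪ 𝒲) k := by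
  obtain ⟨ω, hω, rfl⟩ := hx
  obtain ⟨θ, hθ, rfl⟩ := hy
  refine mk_mem_relativeClasses (ω := cocycleCup h ω θ) ?_
  rintro σ ⟨U, hU | hU, hσ⟩
  · change ω.1.1 _ * θ.1.1 _ = 0
    rw [hω _ (IsSmall.pull ⟨U, hU, hσ⟩ _), zero_mul]
  · change ω.1.1 _ * θ.1.1 _ = 0
    rw [hθ _ (IsSmall.pull ⟨U, hU, hσ⟩ _), mul_zero]

theorem mul_mem_relativeSubgroup {𝒱 𝒲 : Set (Set X)} {x y : CohomologyRing X Γ}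
    (hx : x ∈ relativeSubgroup Γ 𝒱) (hy : y ∈ relativeSubgroup Γ 𝒲) :
    x * y ∈ relativeSubgroup Γ (𝒱 ∪ 𝒲) := by
  classical
  rw [← DirectSum.sum_support_of x, ← DirectSum.sum_support_of y, Finset.sum_mul]
  refine sum_mem fun i _ => ?_
  rw [Finset.mul_sum]
  refine sum_mem fun j _ => ?_
  rw [DirectSum.of_mul_of]
  exact of_mem_relativeSubgroup
    (cohomologyCup_mem_relativeClasses (PNat.add_coe i j).symm (hx i) (hy j))

/-- Each factor that is multiplied to `x` may be taken relative to a categorical set of its own. -/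
theorem foldl_mul_mem_relativeSubgroup {L : List (Set X)} (hL : ∀ U ∈ L, IsCategorical U)
    {l : List (CohomologyRing X Γ)} (hl : l.length = L.length) {𝒱 : Set (Set X)}
    {x : CohomologyRing X Γ} (hx : x ∈ relativeSubgroup Γ 𝒱) :
    l.foldl (· * ·) x ∈ relativeSubgroup Γ (𝒱 ∪ {U | U ∈ L}) := by
  induction L generalizing l x 𝒱 with
  | nil =>
    rw [List.eq_nil_of_length_eq_zero hl]
    simpa using hx
  | cons U L ih =>
    obtain ⟨y, l, rfl⟩ := List.exists_cons_of_length_eq_add_one hl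
    have h := ih (fun V hV => hL V (List.mem_cons_of_mem _ hV)) (Nat.succ.inj hl)
      (mul_mem_relativeSubgroup hx ((hL U List.mem_cons_self).mem_relativeSubgroup y))
    have hset : 𝒱 ∪ {V | V ∈ U :: L} = 𝒱 ∪ {U} ∪ {V | V ∈ L} := by
      ext V
      simp [or_assoc, or_left_comm]
    rw [hset]
    exact h

end Relative

end MT

theorem corollaryc {X : Type*} [TopologicalSpace X] [MeasurableSpace X] [Nonempty X]
    (d : ℕ) (hX : MT.IsMeasurableLamination d X)
    (Γ : Type*) [NonUnitalRing Γ] [MeasurableSpace Γ] [StandardBorelSpace Γ]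
    [MeasurableAdd₂ Γ] [MeasurableNeg Γ] [MeasurableMul₂ Γ] :
    MT.nilpotencyOrder (MT.CohomologyRing X Γ) ≤ MT.cat X := by
  refine le_sInf ?_
  rintro k ⟨𝒰, hcat, hc, rfl⟩
  by_cases hfin : 𝒰.Finite
  swap
  · rw [Set.encard_eq_top_iff.2 hfin]
    exact le_top
  obtain ⟨L, hL, hnodup⟩ : ∃ L : List (Set X), {U | U ∈ L} = 𝒰 ∧ L.Nodup :=
    ⟨hfin.toFinset.toList, by ext; simp, Finset.nodup_toList _⟩
  have hcard : 𝒰.encard = (L.length : ℕ∞) := by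
    classical
    rw [← hL, ← List.toFinset_card_of_nodup hnodup, ← Set.encard_coe_eq_coe_finsetCard]
    congr 1
    ext
    simp
  cases L with
  | nil =>
    have h𝒰 : 𝒰 = ∅ := by simpa using hL.symm
    rw [h𝒰, Set.sUnion_empty] at hc
    exact absurd hc Set.empty_ne_univ
  | cons U L =>
    refine sInf_le ⟨L.length, hcard, fun x l hl => ?_⟩
    have hmem : ∀ V ∈ U :: L, MT.IsCategorical V := fun V hV => hcat V (hL ▸ hV)
    have h := MT.foldl_mul_mem_relativeSubgroup
      (fun V hV => hmem V (List.mem_cons_of_mem _ hV)) hl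
      ((hmem U List.mem_cons_self).mem_relativeSubgroup x)
    have hset : {U} ∪ {V | V ∈ L} = 𝒰 := by
      rw [← hL]
      ext V
      simp
    rw [hset] at h
    exact DFinsupp.ext fun n => MT.eq_zero_of_mem_relativeClasses hfin.countable
      (fun V hV => (hcat V hV).isOpen) (fun V hV => (hcat V hV).measurableSet) hc n.pos (h n)
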